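/- Let $n\ge 0$ be an integer. There is a constant $C>0$ depending only on $n$ with the following property. Let $\Omega\subset\mathbb{R}^{n+1}$ be a bounded open set whose boundary $M=\partial\Omega$ is a generalised hypersurface: for some $\kappa\in[0,1)$ the Hausdorff measure $\mathcal{H}^{n+\kappa}(M)$ is finite, and there are $\delta,\theta>0$ with $\mathcal{H}^{n+\kappa}(M\cap B(p,\gamma))\ge\theta\gamma^{n+\kappa}$ for all $p\in M$ and $\gamma\in(0,\delta]$. Let $d(x,M)$ be the signed distance to $M$, positive in $\Omega$ and non-positive outside $\Omega$. Let $\varepsilon>0$ and let $u$ be the solution of the Allen--Cahn equation $$\partial_t u=\Delta u-\frac1{\varepsilon^2}f(u)\quad\text{on }\mathbb{R}^{n+1}\times(0,\infty),\qquad f(s)=2s(s^2-1),$$ with initial datum $u(\cdot,0)=2\chi_\Omega-1$; that is, $u\in L^\infty(\mathbb{R}^{n+1}\times[0,T])$ for every $T>0$, $u$ is continuous from $[0,\infty)$ to $\mathcal{D}'(\mathbb{R}^{n+1})$, it satisfies the equation in the sense of distributions, $u(\cdot,0)=2\chi_\Omega-1$ almost everywhere, and $u$ is taken to be its continuous representative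 on $\mathbb{R}^{n+1}\times(0,\infty)$. Then for all $x\in\mathbb{R}^{n+1}$ and $t>0$ with $|d(x,M)|\ge 6\sqrt{n+1}\,\sqrt t$, the function $u(\cdot,t)$ is differentiable at $x$ and $$|Du|^2(x,t)\le\frac{C}{t}\exp\left(-\frac{d(x,M)^2}{3t}\right).$$ -/

import Mathlib

open MeasureTheory Set
open scoped ContDiff

noncomputable section

namespace AllenCahn

/-- The Euclidean space of dimension `n + 1`. -/
abbrev Space (n : ℕ) : Type := EuclideanSpace ℝ (Fin (n + 1))

/-- `M` is a generalised hypersurface and `Ω` is the region it bounds: `Ω` is a bounded open set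
with boundary `M`, and for some `κ ∈ [0, 1)` the set `M` has finite `(n + κ)`-dimensional
Hausdorff measure and a uniform lower `(n + κ)`-density bound at small scales. -/
structure IsGeneralisedHypersurface {n : ℕ} (Ω M : Set (Space n)) : Prop where
  isOpen : IsOpen Ω
  isBounded : Bornology.IsBounded Ω
  eq_frontier : M = frontier Ω
  exists_density : ∃ κ : ℝ, 0 ≤ κ ∧ κ < 1 ∧
    Measure.hausdorffMeasure ((n : ℝ) + κ) M < ⊤ ∧
    ∃ δ θ : ℝ, 0 < δ ∧ 0 < θ ∧ ∀ p ∈ M, ∀ γ : ℝ, 0 < γ → γ ≤ δ →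
      ENNReal.ofReal (θ * γ ^ ((n : ℝ) + κ)) ≤
        Measure.hausdorffMeasure ((n : ℝ) + κ) (M ∩ Metric.ball p γ)

open Classical in
/-- Signed distance to `M`, positive inside the region `Ω` bounded by `M`. -/
def signedDist {n : ℕ} (Ω M : Set (Space n)) (x : Space n) : ℝ :=
  if x ∈ Ω then Metric.infDist x M else -Metric.infDist x M

/-- The initial datum `2 χ_Ω - 1`. -/
def initialDatum {n : ℕ} (Ω : Set (Space n)) (x : Space n) : ℝ :=
  2 * Ω.indicator (fun _ => (1 : ℝ)) x - 1

/-- The derivative `f = F'` of the double-well potential `F(s) = (1 - s²)² / 2`. -/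
def nonlinearity (s : ℝ) : ℝ := 2 * s * (s ^ 2 - 1)

/-- `u` is a solution of `∂ₜu = Δu - ε⁻² f(u)` on `ℝⁿ⁺¹ × (0, ∞)` with initial datum `u₀`:
it is in `L^∞(ℝⁿ⁺¹ × [0, T])` for every `T`, it is continuous from `[0, ∞)` into the
distributions on `ℝⁿ⁺¹`, it satisfies the equation in the sense of distributions, and
`u(·, 0) = u₀`. Values of `u` at negative times play no role. -/
structure IsSolution {n : ℕ} (ε : ℝ) (u₀ : Space n → ℝ) (u : Space n → ℝ → ℝ) : Prop where
  memLp_top : ∀ T : ℝ, 0 < T →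
    MemLp (fun p : Space n × ℝ => u p.1 p.2) ⊤ (volume.restrict (univ ×ˢ Icc 0 T))
  locallyIntegrable : ∀ t : ℝ, 0 ≤ t → LocallyIntegrable (fun x => u x t) volume
  continuous_distribution : ∀ ψ : Space n → ℝ, ContDiff ℝ ∞ ψ → HasCompactSupport ψ →
    ContinuousOn (fun t : ℝ => ∫ x, u x t * ψ x) (Ici 0)
  equation : ∀ φ : Space n × ℝ → ℝ, ContDiff ℝ ∞ φ → HasCompactSupport φ →
    tsupport φ ⊆ univ ×ˢ Ioi 0 →
    ∫ p : Space n × ℝ,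
      (u p.1 p.2 * (deriv (fun s => φ (p.1, s)) p.2 +
          Laplacian.laplacian (fun y => φ (y, p.2)) p.1)
        - 1 / ε ^ 2 * nonlinearity (u p.1 p.2) * φ p) = 0
  initial : ∀ᵐ x : Space n, u x 0 = u₀ x

end AllenCahn

end

noncomputable section

namespace AllenCahn

open Filter Topology

/-! Replacing u by -u if necessary, let x lie in Ω, so that the datum is 1 on B(x, d) with d the
distance from x to M. Then u is within a Gaussian error of 1 near x, and an interior estimate on the
parabolic scale passes this error to the gradient. No constant may depend on ε, so the reaction
cannot be treated as a bounded source; its sign and monotonicity are used instead.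

Positivity (`BoundedFlow.three_fifths_le`): u(y, T) ≥ 3/5 when the datum is 1 on a ball about y of
radius greater than 5√((n+1)T). If T ≤ 3ε², the inequality f(u) ≤ (1 - u)/2 makes the reaction a
harmless linear term, and a Gaussian barrier suffices. If T ≥ 3ε², a tanh front on a shrinking
sphere lies below u and has not reached y by time T.

Decay (`BoundedFlow.one_sub_exp_le`): where 0 ≤ u ≤ 1 the reaction is non-negative, so u is a
supersolution of the heat equation and 1 - u ≤ exp(3(n+1)/2 - 3ρ²/(16T)).

Gradient (`HeatLimit.lineDeriv_le`): u minus its reflection in a hyperplane is compared with a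
quadratic barrier on a half ball. Since f increases on [3/5, ∞), the reaction only lowers this
difference where it is positive, and ε drops out. Squaring turns 3/16 into 3/8 > 1/3; the surplus
1/24 absorbs the loss of radius into the constant.

Regularity: u is only a bounded continuous distributional solution. Its spatial mollifications solve
mollified equations classically (`IsSolution.classicalHeat_mollify`) and converge locally uniformly.
The maximum principle is therefore proved for such limits (`HeatLimit.nonpos`), and
differentiability comes from the gradient estimate for differences of mollifications
(`differentiableAt_of_tendsto`). Initial values are reached through the mollifications, which are
continuous up to time 0 (`IsSolution.le_mollify`). -/

/-- The `i`-th coordinate vector. -/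
abbrev coordVec {n : ℕ} (i : Fin (n + 1)) : Space n := EuclideanSpace.single i (1 : ℝ)

/-! ### Pointwise Laplacians along coordinate lines -/

/-- `f` has second derivatives along the coordinate lines through `x`, with sum `L`. -/
def HasLaplacianAt {n : ℕ} (f : Space n → ℝ) (L : ℝ) (x : Space n) : Prop :=
  ∃ D : Fin (n + 1) → ℝ, ∑ i, D i = L ∧ ∀ i, ∃ h' : ℝ → ℝ,
    (∀ᶠ r in 𝓝 (0 : ℝ), HasDerivAt (fun r => f (x + r • coordVec i)) (h' r) r) ∧
      HasDerivAt h' (D i) 0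

namespace HasLaplacianAt

variable {n : ℕ} {f g : Space n → ℝ} {a b : ℝ} {x : Space n}

theorem add (hf : HasLaplacianAt f a x) (hg : HasLaplacianAt g b x) :
    HasLaplacianAt (fun y => f y + g y) (a + b) x := by
  obtain ⟨D, rfl, hD⟩ := hf
  obtain ⟨D', rfl, hD'⟩ := hg
  refine ⟨fun i => D i + D' i, Finset.sum_add_distrib, fun i => ?_⟩
  obtain ⟨h, h1, h2⟩ := hD i
  obtain ⟨k, k1, k2⟩ := hD' i
  refine ⟨fun r => h r + k r, ?_, h2.add k2⟩
  filter_upwards [h1, k1] with r hr kr using hr.add kr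

theorem const_mul (c : ℝ) (hf : HasLaplacianAt f a x) :
    HasLaplacianAt (fun y => c * f y) (c * a) x := by
  obtain ⟨D, rfl, hD⟩ := hf
  refine ⟨fun i => c * D i, (Finset.mul_sum _ _ _).symm, fun i => ?_⟩
  obtain ⟨h, h1, h2⟩ := hD i
  refine ⟨fun r => c * h r, ?_, h2.const_mul c⟩
  filter_upwards [h1] with r hr using hr.const_mul c

theorem const (c : ℝ) : HasLaplacianAt (fun _ => c) 0 x :=
  ⟨fun _ => 0, by simp, fun _ => ⟨fun _ => 0, Eventually.of_forall fun r => hasDerivAt_const r c,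
    hasDerivAt_const _ _⟩⟩

theorem sub (hf : HasLaplacianAt f a x) (hg : HasLaplacianAt g b x) :
    HasLaplacianAt (fun y => f y - g y) (a - b) x := by
  have := hf.add (hg.const_mul (-1))
  simpa [sub_eq_add_neg] using this

theorem congr_val (hf : HasLaplacianAt f a x) (h : a = b) : HasLaplacianAt f b x := h ▸ hf

/-- At a local maximum the Laplacian is non-positive. -/
theorem nonpos_of_isLocalMax (hf : HasLaplacianAt f a x) (hx : IsLocalMax f x) : a ≤ 0 := by
  obtain ⟨D, rfl, hD⟩ := hf
  refine Finset.sum_nonpos fun i _ => ?_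
  obtain ⟨h, h1, h2⟩ := hD i
  by_contra hpos
  push Not at hpos
  set φ : ℝ → ℝ := fun r => f (x + r • coordVec i) with hφ
  have hcont : Tendsto (fun r : ℝ => x + r • coordVec i) (𝓝 0) (𝓝 x) := by
    have : Continuous (fun r : ℝ => x + r • (coordVec i : Space n)) := by fun_prop
    simpa using this.tendsto 0
  have hmax : IsLocalMax φ 0 := by
    have := hcont.eventually hx
    filter_upwards [this] with r hr
    simpa [hφ] using hr
  have hd : deriv φ =ᶠ[𝓝 0] h := by
    filter_upwards [h1] with r hr using hr.deriv
  have hdd : deriv (deriv φ) 0 = D i := by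
    rw [hd.deriv_eq]; exact h2.deriv
  -- A positive second derivative makes the local maximum also a local minimum, so φ is locally
  -- constant and its second derivative vanishes.
  have hmin : IsLocalMin φ 0 :=
    isLocalMin_of_deriv_deriv_pos (by rw [hdd]; exact hpos) hmax.deriv_eq_zero
      h1.self_of_nhds.continuousAt
  have hconst : φ =ᶠ[𝓝 0] fun _ => φ 0 := by
    filter_upwards [hmax, hmin] with r hr1 hr2 using le_antisymm hr1 hr2
  have : deriv (deriv φ) 0 = 0 := by
    have h3 : deriv φ =ᶠ[𝓝 0] fun _ => 0 := by
      filter_upwards [hconst.deriv] with r hr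
      rw [hr]; simp
    rw [h3.deriv_eq]; simp
  linarith

theorem of_contDiff (hf : ContDiff ℝ 2 f) (x : Space n) :
    HasLaplacianAt f (Laplacian.laplacian f x) x := by
  rw [InnerProductSpace.laplacian_eq_iteratedFDeriv_orthonormalBasis f
    (EuclideanSpace.basisFun (Fin (n + 1)) ℝ)]
  refine ⟨_, rfl, fun i => ?_⟩
  refine ⟨fun r => fderiv ℝ f (x + r • coordVec i) (coordVec i),
    Eventually.of_forall fun r => ?_, ?_⟩
  · have h1 : HasFDerivAt f (fderiv ℝ f (x + r • coordVec i)) (x + r • coordVec i) :=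
      (hf.differentiable (by norm_num)).differentiableAt.hasFDerivAt
    have h2 : HasDerivAt (fun r : ℝ => x + r • (coordVec i : Space n)) (coordVec i) r := by
      simpa using ((hasDerivAt_id r).smul_const (coordVec i : Space n)).const_add x
    exact h1.comp_hasDerivAt r h2
  · have hf' : ContDiff ℝ 1 (fderiv ℝ f) := hf.fderiv_right (by norm_num)
    have h1 : HasFDerivAt (fderiv ℝ f) (fderiv ℝ (fderiv ℝ f) x) (x + (0 : ℝ) • coordVec i) := by
      simpa using (hf'.differentiable (by norm_num) x).hasFDerivAt
    have h2 : HasDerivAt (fun r : ℝ => x + r • (coordVec i : Space n)) (coordVec i) 0 := by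
      simpa using ((hasDerivAt_id (0 : ℝ)).smul_const (coordVec i : Space n)).const_add x
    have h3 : HasFDerivAt (fun y => fderiv ℝ f y (coordVec i))
        ((fderiv ℝ (fderiv ℝ f) x).flip (coordVec i)) (x + (0 : ℝ) • coordVec i) :=
      (h1.clm_apply (hasFDerivAt_const (coordVec i : Space n) _)).congr_fderiv (by ext; simp)
    have h4 := h3.comp_hasDerivAt (0 : ℝ) h2
    refine HasDerivAt.congr_deriv h4 ?_
    simp [iteratedFDeriv_two_apply]

theorem norm_add_smul_sub_sq (x c : Space n) (i : Fin (n + 1)) (r : ℝ) :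
    ‖x + r • coordVec i - c‖ ^ 2 = ‖x - c‖ ^ 2 + 2 * r * (x i - c i) + r ^ 2 := by
  have h1 : x + r • (coordVec i : Space n) - c = (x - c) + r • coordVec i :=
    add_sub_right_comm _ _ _
  have h2 : ‖(coordVec i : Space n)‖ = 1 := by simp
  have h3 : inner ℝ (x - c) (coordVec i : Space n) = x i - c i := by
    simp [EuclideanSpace.inner_single_right]
  rw [h1, norm_add_sq_real, inner_smul_right, h3, norm_smul, h2, Real.norm_eq_abs, mul_one,
    sq_abs]
  ring

/-- The Laplacian of a function of the squared distance to a point. -/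
theorem radial {φ φ' : ℝ → ℝ} {φ'' : ℝ} (c x : Space n)
    (h1 : ∀ᶠ q in 𝓝 (‖x - c‖ ^ 2), HasDerivAt φ (φ' q) q)
    (h2 : HasDerivAt φ' φ'' (‖x - c‖ ^ 2)) :
    HasLaplacianAt (fun y => φ (‖y - c‖ ^ 2))
      (4 * ‖x - c‖ ^ 2 * φ'' + 2 * (n + 1) * φ' (‖x - c‖ ^ 2)) x := by
  refine ⟨fun i => 4 * (x i - c i) ^ 2 * φ'' + 2 * φ' (‖x - c‖ ^ 2), ?_, fun i => ?_⟩
  · rw [Finset.sum_add_distrib, ← Finset.sum_mul, ← Finset.mul_sum,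
      EuclideanSpace.norm_sq_eq]
    simp
    ring
  · simp_rw [norm_add_smul_sub_sq]
    set q : ℝ → ℝ := fun r => ‖x - c‖ ^ 2 + 2 * r * (x i - c i) + r ^ 2 with hq
    have hqd : ∀ r, HasDerivAt q (2 * (x i - c i) + 2 * r) r := fun r => by
      refine HasDerivAt.congr_deriv (((((hasDerivAt_id r).const_mul 2).mul_const
        (x i - c i)).const_add (‖x - c‖ ^ 2)).add ((hasDerivAt_id r).pow 2)) ?_
      simp
    have hq0 : q 0 = ‖x - c‖ ^ 2 := by simp [hq]
    have hqc : Tendsto q (𝓝 0) (𝓝 (‖x - c‖ ^ 2)) := by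
      rw [← hq0]; exact (hqd 0).continuousAt
    refine ⟨fun r => φ' (q r) * (2 * (x i - c i) + 2 * r), ?_, ?_⟩
    · filter_upwards [hqc.eventually h1] with r hr
      exact hr.comp r (hqd r)
    · rw [← hq0] at h2
      refine HasDerivAt.congr_deriv ((h2.comp (0 : ℝ) (hqd 0)).mul
        (((hasDerivAt_id (0 : ℝ)).const_mul 2).const_add (2 * (x i - c i)))) ?_
      simp only [Function.comp_apply, hq0]
      simp
      ring

/-- The Laplacian of a function of one coordinate. -/
theorem coord {φ φ' : ℝ → ℝ} {φ'' : ℝ} (i : Fin (n + 1)) (x : Space n)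
    (h1 : ∀ᶠ q in 𝓝 (x i), HasDerivAt φ (φ' q) q)
    (h2 : HasDerivAt φ' φ'' (x i)) :
    HasLaplacianAt (fun y => φ (y i)) φ'' x := by
  refine ⟨fun j => if j = i then φ'' else 0, by simp, fun j => ?_⟩
  by_cases hj : j = i
  · subst hj
    have hd : ∀ r : ℝ, HasDerivAt (fun r : ℝ => x j + r) 1 r := fun r =>
      (hasDerivAt_id r).const_add _
    have hqc : Tendsto (fun r : ℝ => x j + r) (𝓝 0) (𝓝 (x j)) := by
      simpa [ContinuousAt] using (hd 0).continuousAt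
    have hx : ∀ r : ℝ, (x + r • (coordVec j : Space n)) j = x j + r := fun r => by simp
    simp_rw [hx]
    refine ⟨fun r => φ' (x j + r), ?_, ?_⟩
    · filter_upwards [hqc.eventually h1] with r hr
      exact (hr.comp r (hd r)).congr_deriv (mul_one _)
    · have h3 : HasDerivAt φ' φ'' (x j + 0) := by simpa using h2
      exact (h3.comp (0 : ℝ) (hd 0)).congr_deriv (by simp)
  · refine ⟨fun _ => 0, Eventually.of_forall fun r => ?_, ?_⟩
    · have : ∀ r : ℝ, (x + r • (coordVec j : Space n)) i = x i := fun r => by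
        simp [Ne.symm hj]
      simp_rw [this]
      exact hasDerivAt_const _ _
    · simpa [hj] using hasDerivAt_const (0 : ℝ) (0 : ℝ)

end HasLaplacianAt

/-! ### Reflections in coordinate hyperplanes -/

/-- Reflection of the `i`-th coordinate about the point `c`. -/
def reflect {n : ℕ} (c : Space n) (i : Fin (n + 1)) (x : Space n) : Space n :=
  x - (2 * (x i - c i)) • coordVec i

section reflect

variable {n : ℕ} (c : Space n) (i : Fin (n + 1))

theorem continuous_reflect : Continuous (reflect c i) := by
  unfold reflect
  fun_prop

theorem reflect_add_smul (x : Space n) (r : ℝ) (j : Fin (n + 1)) :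
    reflect c i (x + r • coordVec j) =
      reflect c i x + (if j = i then -r else r) • coordVec j := by
  unfold reflect
  ext k
  by_cases hj : j = i
  · subst hj
    by_cases hk : k = j
    · subst hk; simp; ring
    · simp [hk]
  · by_cases hk : k = i
    · subst hk; simp [hj, Ne.symm hj]
    · simp [hj, hk, Ne.symm hj]

theorem norm_reflect_sub (x : Space n) : ‖reflect c i x - c‖ = ‖x - c‖ := by
  have h : ‖reflect c i x - c‖ ^ 2 = ‖x - c‖ ^ 2 := by
    have : reflect c i x - c = x + (-(2 * (x i - c i))) • coordVec i - c := by
      simp [reflect, sub_eq_add_neg]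
    rw [this, HasLaplacianAt.norm_add_smul_sub_sq]
    ring
  exact (pow_left_inj₀ (norm_nonneg _) (norm_nonneg _) two_ne_zero).1 h

theorem reflect_of_eq {x : Space n} (h : x i = c i) : reflect c i x = x := by
  simp [reflect, h]

theorem reflect_center_add (h : ℝ) : reflect c i (c + h • coordVec i) = c - h • coordVec i := by
  rw [reflect_add_smul, reflect_of_eq c i rfl]
  simp [sub_eq_add_neg]

/-- Only the i-th line is reversed, and reversing a line twice differentiated leaves the second
derivative unchanged. -/
theorem HasLaplacianAt.comp_reflect {f : Space n → ℝ} {a : ℝ} {x : Space n}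
    (hf : HasLaplacianAt f a (reflect c i x)) :
    HasLaplacianAt (fun y => f (reflect c i y)) a x := by
  obtain ⟨D, rfl, hD⟩ := hf
  refine ⟨D, rfl, fun j => ?_⟩
  obtain ⟨h, h1, h2⟩ := hD j
  simp_rw [reflect_add_smul]
  by_cases hj : j = i
  · simp only [hj, if_true] at *
    have hn : Tendsto (fun r : ℝ => -r) (𝓝 0) (𝓝 0) := by simpa using (continuous_neg (G := ℝ)).tendsto 0
    refine ⟨fun r => - h (-r), ?_, ?_⟩
    · filter_upwards [hn.eventually h1] with r hr
      exact (hr.comp r (hasDerivAt_neg r)).congr_deriv (by simp)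
    · have h3 : HasDerivAt h (D i) (-0) := by simpa using h2
      exact (h3.comp (0 : ℝ) (hasDerivAt_neg 0)).neg.congr_deriv (by simp)
  · simp only [hj, if_false]
    exact ⟨h, h1, h2⟩

end reflect

/-! ### Classical heat equations with source and their locally uniform limits -/

/-- `w` is a classical solution of `∂ₜw = Δw + g` at the points of `D`. -/
structure ClassicalHeat {n : ℕ} (D : Set (Space n × ℝ)) (w g : Space n → ℝ → ℝ) : Prop where
  continuousOn : ContinuousOn (fun p : Space n × ℝ => w p.1 p.2) D
  equation : ∀ p ∈ D, ∃ L, HasLaplacianAt (fun y => w y p.2) L p.1 ∧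
    HasDerivAt (fun s => w p.1 s) (L + g p.1 p.2) p.2

/-- `(w, g)` is a limit, uniform on the compact subsets of `D`, of pairs for which
`∂ₜw = Δw + g` holds classically. -/
structure HeatLimit {n : ℕ} (D : Set (Space n × ℝ)) (w g : Space n → ℝ → ℝ) : Prop where
  continuousOn : ContinuousOn (fun p : Space n × ℝ => w p.1 p.2) D
  exists_approx : ∃ W G : ℕ → Space n → ℝ → ℝ, (∀ k, ClassicalHeat D (W k) (G k)) ∧
    ∀ K ⊆ D, IsCompact K →
      TendstoUniformlyOn (fun k (p : Space n × ℝ) => W k p.1 p.2) (fun p => w p.1 p.2) atTop K ∧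
      TendstoUniformlyOn (fun k (p : Space n × ℝ) => G k p.1 p.2) (fun p => g p.1 p.2) atTop K

variable {n : ℕ} {D D' : Set (Space n × ℝ)} {w w' g g' : Space n → ℝ → ℝ}

theorem ClassicalHeat.mono (h : ClassicalHeat D w g) (hD : D' ⊆ D) : ClassicalHeat D' w g :=
  ⟨h.continuousOn.mono hD, fun p hp => h.equation p (hD hp)⟩

theorem ClassicalHeat.sub (h : ClassicalHeat D w g) (h' : ClassicalHeat D w' g') :
    ClassicalHeat D (fun x s => w x s - w' x s) (fun x s => g x s - g' x s) := by
  refine ⟨h.continuousOn.sub h'.continuousOn, fun p hp => ?_⟩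
  obtain ⟨L, h1, h2⟩ := h.equation p hp
  obtain ⟨L', h1', h2'⟩ := h'.equation p hp
  refine ⟨L - L', h1.sub h1', (h2.sub h2').congr_deriv (by ring)⟩

/-- Time weights serve twice: an exponential removes a linear source in the maximum principle, and s
- t₀ removes the initial values in the gradient estimate. -/
theorem ClassicalHeat.time_mul {a a' : ℝ → ℝ} (ha : ∀ s, HasDerivAt a (a' s) s)
    (h : ClassicalHeat D w g) :
    ClassicalHeat D (fun x s => a s * w x s) (fun x s => a s * g x s + a' s * w x s) := by
  have hac : Continuous a := continuous_iff_continuousAt.2 fun s => (ha s).continuousAt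
  refine ⟨(hac.comp continuous_snd).continuousOn.mul h.continuousOn, fun p hp => ?_⟩
  obtain ⟨L, h1, h2⟩ := h.equation p hp
  exact ⟨a p.2 * L, h1.const_mul _, ((ha p.2).mul h2).congr_deriv (by ring)⟩

theorem ClassicalHeat.comp_reflect (c : Space n) (i : Fin (n + 1)) (h : ClassicalHeat D w g)
    (hD : ∀ p ∈ D', (reflect c i p.1, p.2) ∈ D) :
    ClassicalHeat D' (fun x s => w (reflect c i x) s) (fun x s => g (reflect c i x) s) := by
  refine ⟨?_, fun p hp => ?_⟩
  · exact h.continuousOn.comp (f := fun p : Space n × ℝ => (reflect c i p.1, p.2))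
      (((continuous_reflect c i).comp continuous_fst).prodMk continuous_snd).continuousOn hD
  · obtain ⟨L, h1, h2⟩ := h.equation _ (hD p hp)
    exact ⟨L, h1.comp_reflect c i, h2⟩

theorem ClassicalHeat.heatLimit (h : ClassicalHeat D w g) : HeatLimit D w g :=
  ⟨h.continuousOn, fun _ => w, fun _ => g, fun _ => h, fun _ _ _ =>
    ⟨fun _ hu => Eventually.of_forall fun _ _ _ => refl_mem_uniformity hu,
      fun _ hu => Eventually.of_forall fun _ _ _ => refl_mem_uniformity hu⟩⟩

theorem HeatLimit.mono (h : HeatLimit D w g) (hD : D' ⊆ D) : HeatLimit D' w g := by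
  obtain ⟨hc, W, G, h1, h2⟩ := h
  exact ⟨hc.mono hD, W, G, fun k => (h1 k).mono hD, fun K hK hKc => h2 K (hK.trans hD) hKc⟩

theorem HeatLimit.sub (h : HeatLimit D w g) (h' : HeatLimit D w' g') :
    HeatLimit D (fun x s => w x s - w' x s) (fun x s => g x s - g' x s) := by
  obtain ⟨hc, W, G, h1, h2⟩ := h
  obtain ⟨hc', W', G', h1', h2'⟩ := h'
  exact ⟨hc.sub hc', _, _, fun k => (h1 k).sub (h1' k), fun K hK hKc =>
    ⟨(h2 K hK hKc).1.sub (h2' K hK hKc).1, (h2 K hK hKc).2.sub (h2' K hK hKc).2⟩⟩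

theorem tendstoUniformlyOn_time_mul {a : ℝ → ℝ} (ha : Continuous a) {K : Set (Space n × ℝ)}
    (hK : IsCompact K) {W : ℕ → Space n → ℝ → ℝ}
    (h : TendstoUniformlyOn (fun k (p : Space n × ℝ) => W k p.1 p.2) (fun p => w p.1 p.2)
      atTop K) :
    TendstoUniformlyOn (fun k (p : Space n × ℝ) => a p.2 * W k p.1 p.2)
      (fun p => a p.2 * w p.1 p.2) atTop K := by
  obtain ⟨C, hC⟩ := hK.exists_bound_of_continuousOn (ha.comp continuous_snd).continuousOn
  rw [Metric.tendstoUniformlyOn_iff] at h ⊢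
  intro ε hε
  filter_upwards [h (ε / (|C| + 1)) (by positivity)] with k hk p hp
  have h1 := hk p hp
  have h2 : |a p.2| ≤ |C| := (hC p hp).trans (le_abs_self C)
  rw [Real.dist_eq] at h1 ⊢
  rw [← mul_sub, abs_mul]
  rw [lt_div_iff₀ (by positivity)] at h1
  nlinarith [abs_nonneg (w p.1 p.2 - W k p.1 p.2)]

theorem HeatLimit.time_mul {a a' : ℝ → ℝ} (ha : ∀ s, HasDerivAt a (a' s) s)
    (ha' : Continuous a') (h : HeatLimit D w g) :
    HeatLimit D (fun x s => a s * w x s) (fun x s => a s * g x s + a' s * w x s) := by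
  have hac : Continuous a := continuous_iff_continuousAt.2 fun s => (ha s).continuousAt
  obtain ⟨hc, W, G, h1, h2⟩ := h
  exact ⟨(hac.comp continuous_snd).continuousOn.mul hc, _, _, fun k => (h1 k).time_mul ha,
    fun K hK hKc => ⟨tendstoUniformlyOn_time_mul hac hKc (h2 K hK hKc).1,
      (tendstoUniformlyOn_time_mul hac hKc (h2 K hK hKc).2).add
        (tendstoUniformlyOn_time_mul ha' hKc (h2 K hK hKc).1)⟩⟩

theorem HeatLimit.comp_reflect (c : Space n) (i : Fin (n + 1)) (h : HeatLimit D w g)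
    (hD : ∀ p ∈ D', (reflect c i p.1, p.2) ∈ D) :
    HeatLimit D' (fun x s => w (reflect c i x) s) (fun x s => g (reflect c i x) s) := by
  obtain ⟨hc, W, G, h1, h2⟩ := h
  have hcont : Continuous fun p : Space n × ℝ => (reflect c i p.1, p.2) :=
    ((continuous_reflect c i).comp continuous_fst).prodMk continuous_snd
  refine ⟨hc.comp (f := fun p : Space n × ℝ => (reflect c i p.1, p.2)) hcont.continuousOn hD,
    _, _, fun k => (h1 k).comp_reflect c i hD, fun K hK hKc => ?_⟩
  have h3 := h2 ((fun p : Space n × ℝ => (reflect c i p.1, p.2)) '' K)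
    (by rintro _ ⟨p, hp, rfl⟩; exact hD p (hK hp)) (hKc.image hcont)
  have hsub := subset_preimage_image (fun p : Space n × ℝ => (reflect c i p.1, p.2)) K
  exact ⟨(h3.1.comp (fun p : Space n × ℝ => (reflect c i p.1, p.2))).mono hsub,
    (h3.2.comp (fun p : Space n × ℝ => (reflect c i p.1, p.2))).mono hsub⟩

/-! ### The weak maximum principle for limits of classical solutions -/

section MaximumPrinciple

variable {n : ℕ} {K U : Set (Space n)} {s₀ t : ℝ} {Z G : Space n → ℝ → ℝ}

/-- The classical argument is run on an approximant. Subtracting η(s - s₀) makes the inequality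
strict by η, which leaves room for an error η/2 in the source. Convergence is needed only on a
compact superlevel set, which avoids the parabolic boundary. -/
theorem HeatLimit.nonpos_of_source_nonpos (hK : IsCompact K) (hU : IsOpen U) (hUK : U ⊆ K)
    (hZ : HeatLimit (U ×ˢ Ioc s₀ t) Z G)
    (hc : ContinuousOn (fun p : Space n × ℝ => Z p.1 p.2) (K ×ˢ Icc s₀ t))
    (hlat : ∀ x ∈ K \ U, ∀ s ∈ Icc s₀ t, Z x s ≤ 0) (hinit : ∀ x ∈ K, Z x s₀ ≤ 0)
    (hG : ∀ x ∈ U, ∀ s ∈ Ioc s₀ t, 0 < Z x s → G x s ≤ 0) :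
    ∀ x ∈ K, ∀ s ∈ Icc s₀ t, Z x s ≤ 0 := by
  intro x₁ hx₁ s₁ hs₁
  by_contra hpos
  push Not at hpos
  have hs₀₁ : s₀ < s₁ := by
    rcases hs₁.1.eq_or_lt with h | h
    · exact absurd (hinit x₁ hx₁) (by rw [h]; exact not_le.2 hpos)
    · exact h
  obtain ⟨η, hη, hη'⟩ : ∃ η > 0, η * (s₁ - s₀) ≤ Z x₁ s₁ / 2 :=
    ⟨Z x₁ s₁ / 2 / (s₁ - s₀), div_pos (half_pos hpos) (sub_pos.2 hs₀₁),
      (div_mul_cancel₀ _ (sub_pos.2 hs₀₁).ne').le⟩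
  set f : Space n × ℝ → ℝ := fun p => Z p.1 p.2 - η * (p.2 - s₀) with hf
  set C : Set (Space n × ℝ) := K ×ˢ Icc s₀ t with hC
  have hfc : ContinuousOn f C := hc.sub (by fun_prop)
  set m := f (x₁, s₁) with hm
  have hmpos : 0 < m := by simp only [hm, hf]; linarith
  set Q : Set (Space n × ℝ) := C ∩ f ⁻¹' Ici (m / 2) with hQ
  have hCc : IsCompact C := hK.prod isCompact_Icc
  have hQc : IsCompact Q :=
    hCc.of_isClosed_subset (hfc.preimage_isClosed_of_isClosed hCc.isClosed isClosed_Ici)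
      inter_subset_left
  have hfZ : ∀ p ∈ C, f p ≤ Z p.1 p.2 := fun p hp => by
    have := mul_nonneg hη.le (sub_nonneg.2 hp.2.1)
    simp only [hf]; linarith
  have hQU : Q ⊆ U ×ˢ Ioc s₀ t := by
    rintro p ⟨hp, hpm⟩
    have h1 : 0 < Z p.1 p.2 := by
      have := hfZ p hp
      have h2 : m / 2 ≤ f p := hpm
      linarith
    refine ⟨?_, lt_of_le_of_ne hp.2.1 ?_, hp.2.2⟩
    · by_contra hpU
      exact absurd (hlat p.1 ⟨hp.1, hpU⟩ p.2 hp.2) (not_le.2 h1)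
    · intro h
      have := hinit p.1 hp.1
      rw [h] at this
      exact absurd this (not_le.2 h1)
  have hx₁Q : (x₁, s₁) ∈ Q := ⟨⟨hx₁, hs₁⟩, by show m / 2 ≤ m; linarith⟩
  obtain ⟨-, W, H, hcl, happ⟩ := hZ
  obtain ⟨hW, hH⟩ := happ Q hQU hQc
  rw [Metric.tendstoUniformlyOn_iff] at hW hH
  obtain ⟨k, hk1, hk2⟩ := ((hW (m / 8) (by positivity)).and (hH (η / 2) (by positivity))).exists
  set fk : Space n × ℝ → ℝ := fun p => W k p.1 p.2 - η * (p.2 - s₀) with hfk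
  have hfkc : ContinuousOn fk Q := ((hcl k).continuousOn.mono hQU).sub (by fun_prop)
  obtain ⟨p, hpQ, hpmax⟩ := hQc.exists_isMaxOn ⟨_, hx₁Q⟩ hfkc
  have hclose : ∀ q ∈ Q, |f q - fk q| < m / 8 := fun q hq => by
    have := hk1 q hq
    rw [Real.dist_eq] at this
    simpa [hf, hfk] using this
  have hp1 : m / 2 < f p := by
    have h1 := hpmax hx₁Q
    have h2 := abs_lt.1 (hclose p hpQ)
    have h3 := abs_lt.1 (hclose _ hx₁Q)
    have h4 : fk (x₁, s₁) ≤ fk p := h1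
    linarith [h2.1, h3.2]
  have hnear : ∀ᶠ q in 𝓝[C] p, fk q ≤ fk p := by
    have h1 : ∀ᶠ q in 𝓝[C] p, m / 2 < f q := (hfc p hpQ.1).eventually (lt_mem_nhds hp1)
    filter_upwards [h1, self_mem_nhdsWithin] with q hq hqC
    exact hpmax ⟨hqC, hq.le⟩
  have hpU := hQU hpQ
  obtain ⟨L, hL1, hL2⟩ := (hcl k).equation p hpU
  have hLmax : IsLocalMax (fun y => W k y p.2) p.1 := by
    have h1 : Tendsto (fun y : Space n => (y, p.2)) (𝓝 p.1) (𝓝[C] p) := by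
      refine tendsto_nhdsWithin_iff.2 ⟨?_, ?_⟩
      · exact (Continuous.prodMk_left p.2).tendsto p.1
      · filter_upwards [hU.mem_nhds hpU.1] with y hy using ⟨hUK hy, hpQ.1.2⟩
    filter_upwards [h1.eventually hnear] with y hy
    simp only [hfk] at hy
    linarith
  have hL := hL1.nonpos_of_isLocalMax hLmax
  have hder : HasDerivAt (fun s => W k p.1 s - η * (s - s₀)) (L + H k p.1 p.2 - η) p.2 := by
    refine (hL2.sub (((hasDerivAt_id p.2).sub_const s₀).const_mul η)).congr_deriv (by simp)
  -- Only earlier times are used, since p may lie on the final slice; the left difference quotients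
  -- are non-negative at a maximum.
  have htime : 0 ≤ L + H k p.1 p.2 - η := by
    have h1 : Tendsto (fun s : ℝ => (p.1, s)) (𝓝[<] p.2) (𝓝[C] p) := by
      refine tendsto_nhdsWithin_iff.2 ⟨?_, ?_⟩
      · exact ((Continuous.prodMk_right p.1).tendsto p.2).mono_left nhdsWithin_le_nhds
      · filter_upwards [Ioo_mem_nhdsLT hpU.2.1] with s hs
        exact ⟨hpQ.1.1, hs.1.le, hs.2.le.trans hpU.2.2⟩
    have h2 := hasDerivAt_iff_tendsto_slope.1 hder
    have h3 := h2.mono_left (nhdsWithin_mono _ (fun s (hs : s < p.2) => hs.ne) :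
      𝓝[<] p.2 ≤ 𝓝[≠] p.2)
    refine ge_of_tendsto h3 ?_
    filter_upwards [h1.eventually hnear, self_mem_nhdsWithin] with s hs hsp
    rw [slope_def_field]
    refine div_nonneg_of_nonpos ?_ (sub_nonpos.2 (le_of_lt hsp))
    simp only [hfk] at hs
    linarith
  have hHG := hk2 p hpQ
  rw [Real.dist_eq] at hHG
  have := hG p.1 hpU.1 p.2 hpU.2 (by linarith [hfZ p hpQ.1])
  linarith [(abs_lt.1 hHG).1]

/-- The weak maximum principle. -/
theorem HeatLimit.nonpos (hK : IsCompact K) (hU : IsOpen U) (hUK : U ⊆ K)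
    (hZ : HeatLimit (U ×ˢ Ioc s₀ t) Z G)
    (hc : ContinuousOn (fun p : Space n × ℝ => Z p.1 p.2) (K ×ˢ Icc s₀ t))
    (hlat : ∀ x ∈ K \ U, ∀ s ∈ Icc s₀ t, Z x s ≤ 0) (hinit : ∀ x ∈ K, Z x s₀ ≤ 0)
    (κ : ℝ) (hG : ∀ x ∈ U, ∀ s ∈ Ioc s₀ t, 0 < Z x s → G x s ≤ κ * Z x s) :
    ∀ x ∈ K, ∀ s ∈ Icc s₀ t, Z x s ≤ 0 := by
  have ha : ∀ s : ℝ, HasDerivAt (fun s => Real.exp (-κ * s)) (-κ * Real.exp (-κ * s)) s :=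
    fun s => ((hasDerivAt_id s).const_mul (-κ)).exp.congr_deriv (by simp; ring)
  have h1 := hZ.time_mul ha (by fun_prop)
  have h2 := h1.nonpos_of_source_nonpos hK hU hUK
    (((by fun_prop : Continuous fun p : Space n × ℝ => Real.exp (-κ * p.2))).continuousOn.mul hc)
    (fun x hx s hs => mul_nonpos_of_nonneg_of_nonpos (Real.exp_pos _).le (hlat x hx s hs))
    (fun x hx => mul_nonpos_of_nonneg_of_nonpos (Real.exp_pos _).le (hinit x hx))
    (fun x hx s hs hp => by
      have hp' := (mul_pos_iff_of_pos_left (Real.exp_pos _)).1 hp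
      have := mul_le_mul_of_nonneg_left (hG x hx s hs hp') (Real.exp_pos (-κ * s)).le
      linarith)
  intro x hx s hs
  exact nonpos_of_mul_nonpos_right (h2 x hx s hs) (Real.exp_pos _)

end MaximumPrinciple

/-! ### Gradient estimate by reflection -/

section Reflection

variable {n : ℕ}

theorem HasLaplacianAt.norm_sub_sq (c x : Space n) :
    HasLaplacianAt (fun y => ‖y - c‖ ^ 2) (2 * (n + 1)) x :=
  (HasLaplacianAt.radial (φ := fun q => q) (φ' := fun _ => 1) (φ'' := 0) c x
    (Eventually.of_forall fun q => hasDerivAt_id q) (hasDerivAt_const _ _)).congr_val (by ring)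

theorem abs_coord_sub_le (x c : Space n) (i : Fin (n + 1)) : |x i - c i| ≤ ‖x - c‖ := by
  have := PiLp.norm_apply_le (x - c) i
  simpa using this

/-- A one-sided bound for a symmetric difference of a solution of the heat equation with source,
by comparison on a half ball with its reflection. -/
theorem HeatLimit.symmetric_difference_le {c : Space n} (i : Fin (n + 1)) {r t₀ t N M : ℝ}
    {w g : Space n → ℝ → ℝ} (hr : 0 < r) (ht : t₀ < t) (hM : 0 ≤ M)
    (hw : HeatLimit (Metric.closedBall c r ×ˢ Icc t₀ t) w g)
    (hN : ∀ x ∈ Metric.closedBall c r, ∀ s ∈ Icc t₀ t, w x s - w (reflect c i x) s ≤ N)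
    (hg : ∀ x ∈ Metric.closedBall c r, ∀ s ∈ Icc t₀ t, 0 < w x s - w (reflect c i x) s →
      g x s - g (reflect c i x) s ≤ M) {h : ℝ} (hh : 0 ≤ h) (hhr : h ≤ r) :
    (t - t₀) * (w (c + h • coordVec i) t - w (c - h • coordVec i) t) ≤
      ((t - t₀) * N + r ^ 2 * ((t - t₀) * M + N) / 2) * (n + 2) / r * h := by
  set τ := t - t₀ with hτ
  have hτpos : 0 < τ := sub_pos.2 ht
  have hN0 : 0 ≤ N := by
    have := hN c (Metric.mem_closedBall_self hr.le) t ⟨ht.le, le_rfl⟩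
    rwa [reflect_of_eq c i rfl, sub_self] at this
  set P := τ * M + N with hP
  have hP0 : 0 ≤ P := by positivity
  set A := τ * N + r ^ 2 * P / 2 with hA
  -- In A the term τN dominates the weighted difference on the sphere, and r²P/2 makes 2A/r²
  -- dominate its source; the summand N of P comes from differentiating the weight s - t₀.
  have hA0 : 0 ≤ A := by positivity
  -- The coefficient n + 2 exceeds n + 1 by one, so the Laplacian of β is -2A/r². On the half ball β
  -- ≥ A‖x - c‖²/r², because 0 ≤ x i - c i ≤ r.
  set β : Space n → ℝ → ℝ := fun x _ => A / r ^ 2 * ‖x - c‖ ^ 2 +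
    (A * (n + 2) / r * (x i - c i) - A * (n + 2) / r ^ 2 * (x i - c i) ^ 2) with hβ
  have hβcl : ClassicalHeat univ β (fun _ _ => 2 * A / r ^ 2) := by
    refine ⟨?_, fun p _ => ⟨-(2 * A / r ^ 2), ?_, ?_⟩⟩
    · exact Continuous.continuousOn (by fun_prop)
    · refine (((HasLaplacianAt.norm_sub_sq c p.1).const_mul (A / r ^ 2)).add
        (HasLaplacianAt.coord (φ := fun q => A * (n + 2) / r * (q - c i) -
          A * (n + 2) / r ^ 2 * (q - c i) ^ 2)
          (φ' := fun q => A * (n + 2) / r - A * (n + 2) / r ^ 2 * (2 * (q - c i)))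
          (φ'' := - (A * (n + 2) / r ^ 2 * 2)) i p.1 (Eventually.of_forall fun q => ?_)
            ?_)).congr_val (by field_simp; ring)
      · exact ((((hasDerivAt_id q).sub_const _).const_mul _).sub
          ((((hasDerivAt_id q).sub_const (c i)).pow 2).const_mul _)).congr_deriv (by simp)
      · exact (((((hasDerivAt_id (p.1 i)).sub_const (c i)).const_mul 2).const_mul
          _).const_sub _).congr_deriv (by simp)
    · exact (hasDerivAt_const _ _).congr_deriv (by simp)
  have hrefl : ∀ x ∈ Metric.closedBall c r, reflect c i x ∈ Metric.closedBall c r := by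
    intro x hx
    rw [mem_closedBall_iff_norm] at hx ⊢
    rwa [norm_reflect_sub]
  have hW := hw.sub (hw.comp_reflect (D' := Metric.closedBall c r ×ˢ Icc t₀ t) c i
    fun p hp => ⟨hrefl _ hp.1, hp.2⟩)
  have hZ := (hW.time_mul (a := fun s => s - t₀) (a' := fun _ => 1)
    (fun s => (hasDerivAt_id s).sub_const t₀) continuous_const).sub
      (hβcl.mono (subset_univ _)).heatLimit
  set K : Set (Space n) := Metric.closedBall c r ∩ {x | c i ≤ x i} with hK
  set U : Set (Space n) := Metric.ball c r ∩ {x | c i < x i} with hU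
  have hci : Continuous fun x : Space n => x i := by fun_prop
  have hβ0 : ∀ x ∈ K, ∀ s, A / r ^ 2 * ‖x - c‖ ^ 2 ≤ β x s := by
    intro x hx s
    have h1 : x i - c i ≤ r :=
      ((le_abs_self _).trans (abs_coord_sub_le x c i)).trans (mem_closedBall_iff_norm.1 hx.1)
    have h2 : 0 ≤ x i - c i := sub_nonneg.2 hx.2
    have h3 : A * (n + 2) / r * (x i - c i) - A * (n + 2) / r ^ 2 * (x i - c i) ^ 2 =
        A * (n + 2) / r ^ 2 * ((x i - c i) * (r - (x i - c i))) := by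
      field_simp
    have h4 : 0 ≤ A * (n + 2) / r ^ 2 * ((x i - c i) * (r - (x i - c i))) :=
      mul_nonneg (by positivity) (mul_nonneg h2 (sub_nonneg.2 h1))
    simp only [hβ]
    linarith
  have hβ0' : ∀ x ∈ K, ∀ s, 0 ≤ β x s := fun x hx s =>
    (by positivity : (0 : ℝ) ≤ A / r ^ 2 * ‖x - c‖ ^ 2).trans (hβ0 x hx s)
  have key := hZ.mono (D' := U ×ˢ Ioc t₀ t) (prod_mono
    (inter_subset_left.trans Metric.ball_subset_closedBall) Ioc_subset_Icc_self) |>.nonpos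
    (K := K) ((isCompact_closedBall c r).inter_right (isClosed_le continuous_const hci))
    (Metric.isOpen_ball.inter (isOpen_lt continuous_const hci))
    (inter_subset_inter Metric.ball_subset_closedBall fun x (hx : c i < x i) => le_of_lt hx)
    (hZ.continuousOn.mono (prod_mono inter_subset_left le_rfl)) ?_ ?_ 0 ?_
  · have h1 : c + h • coordVec i ∈ K := by
      refine ⟨?_, ?_⟩
      · rw [mem_closedBall_iff_norm]
        simpa [norm_smul, abs_of_nonneg hh] using hhr
      · simpa using hh
    have h2 := key _ h1 t ⟨ht.le, le_rfl⟩
    rw [reflect_center_add] at h2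
    have h3 : β (c + h • coordVec i) t ≤ A * (n + 2) / r * h := by
      have h4 : ‖c + h • (coordVec i : Space n) - c‖ ^ 2 = h ^ 2 := by
        rw [add_sub_cancel_left, norm_smul]; simp
      have h5 : (c + h • (coordVec i : Space n)) i - c i = h := by simp
      simp only [hβ, h4, h5]
      have h6 : A / r ^ 2 * h ^ 2 + (A * (n + 2) / r * h - A * (n + 2) / r ^ 2 * h ^ 2) =
        A * (n + 2) / r * h - A * (n + 1) / r ^ 2 * h ^ 2 := by ring
      rw [h6]
      have : 0 ≤ A * (n + 1) / r ^ 2 * h ^ 2 := by positivity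
      linarith
    linarith
  · rintro x ⟨hx, hxU⟩ s hs
    -- On the flat face the reflected difference vanishes; on the spherical part β is at least A.
    by_cases hxi : x i = c i
    · have := hβ0' x hx s
      simp only [reflect_of_eq c i hxi]
      linarith
    · have h1 : r ≤ ‖x - c‖ := by
        by_contra hlt
        exact hxU ⟨mem_ball_iff_norm.2 (not_le.1 hlt), lt_of_le_of_ne hx.2 (Ne.symm hxi)⟩
      have h2 : A ≤ A / r ^ 2 * ‖x - c‖ ^ 2 := by
        rw [div_mul_eq_mul_div, le_div_iff₀ (by positivity)]
        gcongr
      have h3 := hβ0 x hx s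
      have h4 : (s - t₀) * (w x s - w (reflect c i x) s) ≤ τ * N :=
        (mul_le_mul_of_nonneg_left (hN x hx.1 s hs) (sub_nonneg.2 hs.1)).trans
          (mul_le_mul_of_nonneg_right (sub_le_sub_right hs.2 _) hN0)
      have h5 : 0 ≤ r ^ 2 * P / 2 := by positivity
      linarith
  · intro x hx
    have := hβ0' x hx t₀
    simp only [sub_self, zero_mul]
    linarith
  · intro x hx s hs hpos
    have hxK : x ∈ Metric.closedBall c r := Metric.ball_subset_closedBall hx.1
    have hxK' : x ∈ K := ⟨hxK, (show c i < x i from hx.2).le⟩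
    have hs' := Ioc_subset_Icc_self hs
    have h1 : 0 < w x s - w (reflect c i x) s := by
      have := hβ0' x hxK' s
      exact pos_of_mul_pos_right (lt_of_le_of_lt this (by linarith)) (sub_pos.2 hs.1).le
    have h2 := hg x hxK s hs' h1
    have h3 := hN x hxK s hs'
    have h4 : (s - t₀) * (g x s - g (reflect c i x) s) ≤ τ * M :=
      (mul_le_mul_of_nonneg_left h2 (sub_nonneg.2 hs.1.le)).trans
        (mul_le_mul_of_nonneg_right (sub_le_sub_right hs.2 _) hM)
    have h5 : P ≤ 2 * A / r ^ 2 := by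
      rw [le_div_iff₀ (by positivity)]
      have : 0 ≤ τ * N := by positivity
      simp only [hA]
      linarith
    linarith

/-- A bound for a directional derivative of a solution of the heat equation with source. -/
theorem HeatLimit.lineDeriv_le {c : Space n} (i : Fin (n + 1)) {r t₀ t N M : ℝ}
    {w g : Space n → ℝ → ℝ} (hr : 0 < r) (ht : t₀ < t) (hM : 0 ≤ M)
    (hw : HeatLimit (Metric.closedBall c r ×ˢ Icc t₀ t) w g)
    (hN : ∀ x ∈ Metric.closedBall c r, ∀ s ∈ Icc t₀ t, w x s - w (reflect c i x) s ≤ N)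
    (hg : ∀ x ∈ Metric.closedBall c r, ∀ s ∈ Icc t₀ t, 0 < w x s - w (reflect c i x) s →
      g x s - g (reflect c i x) s ≤ M)
    {w' : Space n →L[ℝ] ℝ} (hd : HasFDerivAt (fun y => w y t) w' c) :
    2 * (t - t₀) * w' (coordVec i) ≤
      ((t - t₀) * N + r ^ 2 * ((t - t₀) * M + N) / 2) * (n + 2) / r := by
  have h1 : HasDerivAt (fun h : ℝ => w (c + h • coordVec i) t) (w' (coordVec i)) 0 := by
    have hl : HasDerivAt (fun h : ℝ => c + h • (coordVec i : Space n)) (coordVec i) 0 := by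
      simpa using ((hasDerivAt_id (0 : ℝ)).smul_const (coordVec i : Space n)).const_add c
    have hd' : HasFDerivAt (fun y => w y t) w' (c + (0 : ℝ) • coordVec i) := by simpa using hd
    exact hd'.comp_hasDerivAt (0 : ℝ) hl
  have h2 : HasDerivAt (fun h : ℝ => w (c - h • coordVec i) t) (-w' (coordVec i)) 0 := by
    have hl : HasDerivAt (fun h : ℝ => c - h • (coordVec i : Space n)) (-coordVec i) 0 := by
      simpa using ((hasDerivAt_id (0 : ℝ)).smul_const (coordVec i : Space n)).const_sub c
    have hd' : HasFDerivAt (fun y => w y t) w' (c - (0 : ℝ) • coordVec i) := by simpa using hd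
    have h := hd'.comp_hasDerivAt (0 : ℝ) hl
    exact h.congr_deriv (by simp)
  have h3 := (h1.sub h2).const_mul (t - t₀)
  have h4 := (hasDerivAt_iff_tendsto_slope.1 h3).mono_left
    (nhdsWithin_mono _ (fun s (hs : 0 < s) => hs.ne') : 𝓝[>] (0 : ℝ) ≤ 𝓝[≠] 0)
  have h5 : (t - t₀) * (w' (coordVec i) - -w' (coordVec i)) ≤
      ((t - t₀) * N + r ^ 2 * ((t - t₀) * M + N) / 2) * (n + 2) / r := by
    refine le_of_tendsto h4 ?_
    filter_upwards [Ioo_mem_nhdsGT hr] with h hh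
    rw [slope_def_field, sub_zero, div_le_iff₀ hh.1]
    have := hw.symmetric_difference_le i hr ht hM hN hg hh.1.le hh.2.le
    simpa using this
  linarith

end Reflection

/-! ### Spatial differentiability of limits -/

section Differentiability

variable {n : ℕ}

theorem norm_le_of_forall_coordVec (ℓ : Space n →L[ℝ] ℝ) {a : ℝ}
    (h : ∀ i, |ℓ (coordVec i)| ≤ a) : ‖ℓ‖ ≤ (n + 1) * a := by
  have ha : 0 ≤ a := (abs_nonneg _).trans (h 0)
  refine ℓ.opNorm_le_bound (by positivity) fun v => ?_
  have hv : v = ∑ i, v i • (coordVec i : Space n) := by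
    have := (EuclideanSpace.basisFun (Fin (n + 1)) ℝ).sum_repr v
    simpa using this.symm
  have h1 : ℓ v = ∑ i, v i * ℓ (coordVec i) := by
    conv_lhs => rw [hv]
    simp
  rw [h1]
  refine (norm_sum_le _ _).trans ?_
  have h2 : ∀ i ∈ Finset.univ, ‖v i * ℓ (coordVec i)‖ ≤ a * ‖v‖ := fun i _ => by
    rw [norm_mul, mul_comm]
    exact mul_le_mul (h i) (PiLp.norm_apply_le v i) (norm_nonneg _) ha
  refine (Finset.sum_le_sum h2).trans ?_
  simp
  linarith

/-- A locally uniform limit of classical solutions of heat equations with locally uniformly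
convergent sources is differentiable in space. -/
theorem differentiableAt_of_tendsto {u F : Space n → ℝ → ℝ} {W G : ℕ → Space n → ℝ → ℝ}
    (hcl : ∀ k, ClassicalHeat (univ ×ˢ Ioi 0) (W k) (G k))
    (hdiff : ∀ k s, 0 < s → Differentiable ℝ fun y => W k y s)
    (hconv : ∀ K ⊆ (univ : Set (Space n)) ×ˢ Ioi (0 : ℝ), IsCompact K →
      TendstoUniformlyOn (fun k (p : Space n × ℝ) => W k p.1 p.2) (fun p => u p.1 p.2) atTop K ∧
      TendstoUniformlyOn (fun k (p : Space n × ℝ) => G k p.1 p.2) (fun p => F p.1 p.2) atTop K)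
    {t : ℝ} (ht : 0 < t) (x : Space n) : DifferentiableAt ℝ (fun y => u y t) x := by
  set K : Set (Space n × ℝ) := Metric.closedBall x 2 ×ˢ Icc (t / 2) t with hK
  have hKsub : K ⊆ univ ×ˢ Ioi 0 := fun p hp => ⟨mem_univ _, by
    have := hp.2.1
    show 0 < p.2
    linarith⟩
  obtain ⟨hW, hG⟩ := hconv K hKsub ((isCompact_closedBall x 2).prod isCompact_Icc)
  have hc := hW.uniformCauchySeqOn
  have hc' := hG.uniformCauchySeqOn
  have hxK : ∀ y ∈ Metric.ball x 1, (y, t) ∈ K := fun y hy =>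
    ⟨Metric.ball_subset_closedBall (Metric.ball_subset_ball (by norm_num) hy),
      by constructor <;> linarith⟩
  have hcauchy : UniformCauchySeqOn (fun k y => fderiv ℝ (fun z => W k z t) y) atTop
      (Metric.ball x 1) := by
    rw [Metric.uniformCauchySeqOn_iff] at hc hc' ⊢
    intro ε hε
    -- This is the constant of the reflection estimate on a unit ball and the time interval [t/2, t]
    -- with N = M = 2e, times the factor n + 1 from `norm_le_of_forall_coordVec`.
    set A : ℝ := (n + 1) * ((3 * t / 2 + 1) * (n + 2) / t) with hA
    have hA0 : 0 < A := by positivity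
    set e := ε / (2 * A) with he
    have he0 : 0 < e := by positivity
    obtain ⟨m₁, h₁⟩ := hc e he0
    obtain ⟨m₂, h₂⟩ := hc' e he0
    have hone : ∀ j ≥ max m₁ m₂, ∀ k ≥ max m₁ m₂, ∀ y ∈ Metric.ball x 1, ∀ i,
        (fderiv ℝ (fun z => W j z t) y - fderiv ℝ (fun z => W k z t) y) (coordVec i) ≤
          (3 * t / 2 + 1) * (n + 2) / t * e := by
      intro j hj k hk y hy i
      have hsub : Metric.closedBall y 1 ⊆ Metric.closedBall x 2 := by
        refine Metric.closedBall_subset_closedBall' ?_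
        have := Metric.mem_ball.1 hy
        linarith
      have hb : ∀ z ∈ Metric.closedBall y 1, ∀ s ∈ Icc (t / 2) t,
          |W j z s - W k z s| < e ∧ |G j z s - G k z s| < e := fun z hz s hs =>
        ⟨h₁ j (le_of_max_le_left hj) k (le_of_max_le_left hk) (z, s) ⟨hsub hz, hs⟩,
          h₂ j (le_of_max_le_right hj) k (le_of_max_le_right hk) (z, s) ⟨hsub hz, hs⟩⟩
      have hr : ∀ z ∈ Metric.closedBall y 1, reflect y i z ∈ Metric.closedBall y 1 := by
        intro z hz
        rw [mem_closedBall_iff_norm] at hz ⊢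
        rwa [norm_reflect_sub]
      have hheat := (((hcl j).sub (hcl k)).mono (D' := Metric.closedBall y 1 ×ˢ Icc (t / 2) t)
        ((prod_mono hsub le_rfl).trans hKsub)).heatLimit
      have hder : HasFDerivAt (fun z => W j z t - W k z t)
          (fderiv ℝ (fun z => W j z t) y - fderiv ℝ (fun z => W k z t) y) y :=
        (hdiff j t ht y).hasFDerivAt.sub (hdiff k t ht y).hasFDerivAt
      have h3 := hheat.lineDeriv_le (N := 2 * e) (M := 2 * e) i one_pos (by linarith)
        (by positivity) (fun z hz s hs => ?_) (fun z hz s hs _ => ?_) hder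
      · rw [div_mul_eq_mul_div, le_div_iff₀ ht]
        have h4 : 2 * (t - t / 2) = t := by ring
        rw [h4] at h3
        refine (mul_comm _ _).trans_le (h3.trans_eq ?_)
        ring
      · have a1 := abs_lt.1 (hb z hz s hs).1
        have a2 := abs_lt.1 (hb _ (hr z hz) s hs).1
        linarith [a1.2, a2.1]
      · have a1 := abs_lt.1 (hb z hz s hs).2
        have a2 := abs_lt.1 (hb _ (hr z hz) s hs).2
        linarith [a1.2, a2.1]
    refine ⟨max m₁ m₂, fun j hj k hk y hy => ?_⟩
    rw [dist_eq_norm]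
    have h5 := norm_le_of_forall_coordVec
      (fderiv ℝ (fun z => W j z t) y - fderiv ℝ (fun z => W k z t) y)
      (a := (3 * t / 2 + 1) * (n + 2) / t * e) fun i => abs_le.2 ⟨by
        have := hone k hk j hj y hy i
        rw [← neg_sub, neg_apply] at this
        linarith, hone j hj k hk y hy i⟩
    have h6 : (n + 1) * ((3 * t / 2 + 1) * (n + 2) / t * e) = ε / 2 := by
      rw [← mul_assoc, ← hA, he]; field_simp
    linarith
  have hlim : ∀ y ∈ Metric.ball x 1, ∃ ℓ, Tendsto (fun k => fderiv ℝ (fun z => W k z t) y) atTop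
      (𝓝 ℓ) := fun y hy => cauchySeq_tendsto_of_complete (hcauchy.cauchySeq hy)
  choose! g' hg' using hlim
  have hunif := hcauchy.tendstoUniformlyOn_of_tendsto hg'
  exact (hasFDerivAt_of_tendstoUniformlyOn Metric.isOpen_ball hunif
    (fun k y _ => (hdiff k t ht y).hasFDerivAt)
    (fun y hy => hW.tendsto_at (hxK y hy)) (Metric.mem_ball_self one_pos)).differentiableAt

end Differentiability

/-! ### Convolution in space -/

section Mollification

variable {n : ℕ}

theorem HasLaplacianAt.unique {f : Space n → ℝ} {a b : ℝ} {x : Space n}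
    (ha : HasLaplacianAt f a x) (hb : HasLaplacianAt f b x) : a = b := by
  obtain ⟨D, rfl, hD⟩ := ha
  obtain ⟨D', rfl, hD'⟩ := hb
  refine Finset.sum_congr rfl fun i _ => ?_
  obtain ⟨h, h1, h2⟩ := hD i
  obtain ⟨k, k1, k2⟩ := hD' i
  refine (h2.congr_of_eventuallyEq (f₁ := k) ?_).unique k2
  filter_upwards [h1, k1] with r hr kr using kr.unique hr

theorem HasLaplacianAt.comp_const_sub {f : Space n → ℝ} {a : ℝ} {x y : Space n}
    (hf : HasLaplacianAt f a (x - y)) : HasLaplacianAt (fun y => f (x - y)) a y := by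
  obtain ⟨D, rfl, hD⟩ := hf
  refine ⟨D, rfl, fun j => ?_⟩
  obtain ⟨h, h1, h2⟩ := hD j
  have hx : ∀ r : ℝ, x - (y + r • (coordVec j : Space n)) = x - y + (-r) • coordVec j := fun r => by
    rw [neg_smul, ← sub_eq_add_neg, sub_add_eq_sub_sub]
  simp_rw [hx]
  have hn : Tendsto (fun r : ℝ => -r) (𝓝 0) (𝓝 0) := by
    simpa using (continuous_neg (G := ℝ)).tendsto 0
  refine ⟨fun r => - h (-r), ?_, ?_⟩
  · filter_upwards [hn.eventually h1] with r hr
    exact (hr.comp r (hasDerivAt_neg r)).congr_deriv (by simp)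
  · have h3 : HasDerivAt h (D j) (-0) := by simpa using h2
    exact (h3.comp (0 : ℝ) (hasDerivAt_neg 0)).neg.congr_deriv (by simp)

/-- Needed because mollifying at x means testing with y ↦ ψ (x - y), whose Laplacian in y must be
turned back into a Laplacian of the kernel. -/
theorem laplacian_comp_const_sub {ψ : Space n → ℝ} (hψ : ContDiff ℝ 2 ψ) (x y : Space n) :
    Laplacian.laplacian (fun y => ψ (x - y)) y = Laplacian.laplacian ψ (x - y) :=
  (HasLaplacianAt.of_contDiff (hψ.comp (contDiff_const.sub contDiff_id)) y).unique
    (HasLaplacianAt.of_contDiff hψ (x - y)).comp_const_sub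

/-- The convolution of `g` with the kernel `ψ`. -/
def mollify (g ψ : Space n → ℝ) (x : Space n) : ℝ := ∫ y, g y * ψ (x - y)

theorem mollify_eq_convolution (g ψ : Space n → ℝ) :
    mollify g ψ = convolution g ψ (ContinuousLinearMap.mul ℝ ℝ) volume := rfl

variable {g ψ : Space n → ℝ}

theorem contDiff_mollify (hg : LocallyIntegrable g) (hψ : ContDiff ℝ ∞ ψ)
    (hc : HasCompactSupport ψ) : ContDiff ℝ ∞ (mollify g ψ) := by
  rw [mollify_eq_convolution]
  exact hc.contDiff_convolution_right _ hg hψ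

theorem hasDerivAt_mollify (hg : LocallyIntegrable g) (hψ : ContDiff ℝ 1 ψ)
    (hc : HasCompactSupport ψ) (x : Space n) (i : Fin (n + 1)) (r : ℝ) :
    HasDerivAt (fun r => mollify g ψ (x + r • coordVec i))
      (mollify g (fun z => fderiv ℝ ψ z (coordVec i)) (x + r • coordVec i)) r := by
  have h1 := hc.hasFDerivAt_convolution_right (ContinuousLinearMap.mul ℝ ℝ) hg hψ
    (x + r • coordVec i)
  have hl : HasDerivAt (fun r : ℝ => x + r • (coordVec i : Space n)) (coordVec i) r := by
    simpa using ((hasDerivAt_id r).smul_const (coordVec i : Space n)).const_add x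
  have h2 := h1.comp_hasDerivAt r hl
  rw [convolution_precompR_apply _ hg (hc.fderiv ℝ)
    (hψ.continuous_fderiv (by norm_num))] at h2
  exact h2

theorem laplacian_eq_sum {ψ : Space n → ℝ} (hψ : ContDiff ℝ 2 ψ) (z : Space n) :
    Laplacian.laplacian ψ z =
      ∑ i, fderiv ℝ (fun z => fderiv ℝ ψ z (coordVec i)) z (coordVec i) := by
  rw [InnerProductSpace.laplacian_eq_iteratedFDeriv_orthonormalBasis ψ
    (EuclideanSpace.basisFun (Fin (n + 1)) ℝ)]
  refine Finset.sum_congr rfl fun i _ => ?_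
  have hf' : ContDiff ℝ 1 (fderiv ℝ ψ) := hψ.fderiv_right (by norm_num)
  have h1 : HasFDerivAt (fderiv ℝ ψ) (fderiv ℝ (fderiv ℝ ψ) z) z :=
    (hf'.differentiable (by norm_num) z).hasFDerivAt
  have h3 : HasFDerivAt (fun y => fderiv ℝ ψ y (coordVec i))
      ((fderiv ℝ (fderiv ℝ ψ) z).flip (coordVec i)) z :=
    (h1.clm_apply (hasFDerivAt_const (coordVec i : Space n) _)).congr_fderiv (by ext; simp)
  rw [h3.fderiv]
  simp [iteratedFDeriv_two_apply]

theorem contDiff_lineDeriv {ψ : Space n → ℝ} (hψ : ContDiff ℝ ∞ ψ) (v : Space n) :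
    ContDiff ℝ ∞ fun z => fderiv ℝ ψ z v :=
  (hψ.fderiv_right (m := ∞) (by simp)).clm_apply contDiff_const

theorem hasCompactSupport_lineDeriv {ψ : Space n → ℝ} (hc : HasCompactSupport ψ) (v : Space n) :
    HasCompactSupport fun z => fderiv ℝ ψ z v :=
  (hc.fderiv ℝ).comp_left (g := fun l : Space n →L[ℝ] ℝ => l v) (by simp)

theorem continuous_laplacian {ψ : Space n → ℝ} (hψ : ContDiff ℝ ∞ ψ) :
    Continuous (Laplacian.laplacian ψ : Space n → ℝ) := by
  have : (Laplacian.laplacian ψ : Space n → ℝ) =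
      fun z => ∑ i, fderiv ℝ (fun z => fderiv ℝ ψ z (coordVec i)) z (coordVec i) :=
    funext (laplacian_eq_sum (hψ.of_le (by norm_cast)))
  rw [this]
  exact continuous_finsetSum _ fun i _ =>
    (contDiff_lineDeriv (contDiff_lineDeriv hψ _) _).continuous

theorem hasCompactSupport_laplacian {ψ : Space n → ℝ} (hc : HasCompactSupport ψ) :
    HasCompactSupport (Laplacian.laplacian ψ : Space n → ℝ) := by
  refine HasCompactSupport.intro hc fun z hz => ?_
  have h : ψ =ᶠ[𝓝 z] fun _ => 0 := notMem_tsupport_iff_eventuallyEq.1 hz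
  have := (InnerProductSpace.laplacian_congr_nhds h).self_of_nhds
  rw [this, InnerProductSpace.laplacian_const]
  rfl

theorem integrable_mul_of_hasCompactSupport (hg : LocallyIntegrable g) (hψ : Continuous ψ)
    (hc : HasCompactSupport ψ) : Integrable fun y => g y * ψ y := by
  simpa [mul_comm] using hg.integrable_smul_left_of_hasCompactSupport hψ hc

theorem HasCompactSupport.comp_const_sub {ψ : Space n → ℝ} (hc : HasCompactSupport ψ)
    (x : Space n) : HasCompactSupport fun y => ψ (x - y) :=
  hc.comp_homeomorph (Homeomorph.subLeft x)

theorem hasLaplacianAt_mollify (hg : LocallyIntegrable g) (hψ : ContDiff ℝ ∞ ψ)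
    (hc : HasCompactSupport ψ) (x : Space n) :
    HasLaplacianAt (mollify g ψ) (mollify g (Laplacian.laplacian ψ) x) x := by
  have h1 : ContDiff ℝ 1 ψ := hψ.of_le (by norm_cast)
  have h2 : ContDiff ℝ 2 ψ := hψ.of_le (by norm_cast)
  refine ⟨fun i => mollify g (fun z => fderiv ℝ (fun z => fderiv ℝ ψ z (coordVec i)) z
    (coordVec i)) x, ?_, fun i => ⟨_, Eventually.of_forall fun r => hasDerivAt_mollify hg h1 hc
      x i r, ?_⟩⟩
  · simp only [mollify]
    rw [← integral_finsetSum]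
    · simp_rw [← Finset.mul_sum, laplacian_eq_sum h2]
    · intro i _
      exact integrable_mul_of_hasCompactSupport hg
        ((contDiff_lineDeriv (contDiff_lineDeriv hψ _) _).continuous.comp (by fun_prop))
        (HasCompactSupport.comp_const_sub
          (hasCompactSupport_lineDeriv (hasCompactSupport_lineDeriv hc _) _) x)
  · have := hasDerivAt_mollify hg ((contDiff_lineDeriv hψ (coordVec i)).of_le
      (by norm_cast)) (hasCompactSupport_lineDeriv hc (coordVec i)) x i 0
    simpa using this

end Mollification

/-! ### The du Bois-Reymond lemma on the half line -/

section DuBoisReymond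

/-- Averaging against a concentrated normalised bump recovers point values, so integral identities
can be read pointwise. -/
theorem exists_bump_integral_near {h : ℝ → ℝ} {a ε : ℝ} (ha : 0 < a)
    (hh : ContinuousOn h (Ioi 0)) (hε : 0 < ε) :
    ∃ φ : ℝ → ℝ, ContDiff ℝ ∞ φ ∧ HasCompactSupport φ ∧ tsupport φ ⊆ Ioi 0 ∧
      ∫ s, φ s = 1 ∧ |(∫ s, φ s * h s) - h a| ≤ ε := by
  have hc : ContinuousAt h a := hh.continuousAt (Ioi_mem_nhds ha)
  obtain ⟨δ, hδ, hδh⟩ := Metric.continuousAt_iff.1 hc ε hε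
  set κ := min (δ / 2) (a / 2) with hκ
  have hκ0 : 0 < κ := by positivity
  let b : ContDiffBump a := ⟨κ / 2, κ, by positivity, by linarith⟩
  have hts : tsupport (b.normed volume) = Metric.closedBall a κ := b.tsupport_normed_eq
  have hsub : tsupport (b.normed volume) ⊆ Ioi 0 := by
    rw [hts]
    intro s hs
    have h1 := abs_le.1 (Real.dist_eq s a ▸ Metric.mem_closedBall.1 hs)
    have h2 : κ ≤ a / 2 := min_le_right _ _
    show 0 < s
    linarith [h1.1]
  have hint : Integrable fun s => b.normed volume s * h s := by
    have hcont : Continuous fun s => b.normed volume s * h s := by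
      refine continuous_of_tsupport fun s hs => ?_
      have hs' : s ∈ Ioi (0 : ℝ) := hsub (tsupport_mul_subset_left hs)
      exact b.continuous_normed.continuousAt.mul (hh.continuousAt (Ioi_mem_nhds hs'))
    exact hcont.integrable_of_hasCompactSupport b.hasCompactSupport_normed.mul_right
  refine ⟨b.normed volume, b.contDiff_normed, b.hasCompactSupport_normed, hsub,
    b.integral_normed, ?_⟩
  have h0 : (∫ s, b.normed volume s * h s) - h a = ∫ s, b.normed volume s * (h s - h a) := by
    simp_rw [mul_sub]
    rw [integral_sub hint (b.integrable_normed.mul_const _), integral_mul_const,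
      b.integral_normed, one_mul]
  rw [h0, ← Real.norm_eq_abs]
  have h2 : ∀ s, ‖b.normed volume s * (h s - h a)‖ ≤ b.normed volume s * ε := by
    intro s
    rw [norm_mul, Real.norm_of_nonneg (b.nonneg_normed s)]
    by_cases hs : s ∈ tsupport (b.normed volume)
    · refine mul_le_mul_of_nonneg_left ?_ (b.nonneg_normed s)
      rw [hts] at hs
      have h3 : dist s a < δ := by
        have h4 := Metric.mem_closedBall.1 hs
        have h5 : κ ≤ δ / 2 := min_le_left _ _
        linarith
      have := hδh h3
      rw [Real.dist_eq] at this
      exact this.le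
    · rw [image_eq_zero_of_notMem_tsupport hs]; simp
  calc ‖∫ s, b.normed volume s * (h s - h a)‖ ≤ ∫ s, b.normed volume s * ε :=
        norm_integral_le_of_norm_le (b.integrable_normed.mul_const _) (Eventually.of_forall h2)
    _ = ε := by rw [integral_mul_const, b.integral_normed, one_mul]

/-- A primitive of a compactly supported smooth function of vanishing integral. -/
theorem exists_primitive {φ : ℝ → ℝ} (hφ : ContDiff ℝ ∞ φ) (hc : HasCompactSupport φ)
    (hpos : tsupport φ ⊆ Ioi 0) (h0 : ∫ s, φ s = 0) :
    ∃ η : ℝ → ℝ, ContDiff ℝ ∞ η ∧ HasCompactSupport η ∧ tsupport η ⊆ Ioi 0 ∧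
      ∀ s, HasDerivAt η (φ s) s := by
  have hder : ∀ s, HasDerivAt (fun s => ∫ τ in (0 : ℝ)..s, φ τ) (φ s) s := fun s =>
    hφ.continuous.integral_hasStrictDerivAt 0 s |>.hasDerivAt
  obtain ⟨a, ha, b, hab⟩ : ∃ a > 0, ∃ b, tsupport φ ⊆ Icc a b := by
    rcases (tsupport φ).eq_empty_or_nonempty with h | h
    · exact ⟨1, one_pos, 1, by rw [h]; exact empty_subset _⟩
    · obtain ⟨a, haS, ha⟩ := hc.isCompact.exists_isLeast h
      obtain ⟨b, -, hb⟩ := hc.isCompact.exists_isGreatest h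
      exact ⟨a, hpos haS, b, fun s hs => ⟨ha hs, hb hs⟩⟩
  have hz : ∀ s, s ∉ Icc a b → φ s = 0 := fun s hs =>
    image_eq_zero_of_notMem_tsupport fun h => hs (hab h)
  have hout : ∀ s, s ∉ Icc a b → ∫ τ in (0 : ℝ)..s, φ τ = 0 := by
    intro s hs
    by_cases hsa : s < a
    · refine intervalIntegral.integral_zero_ae (Eventually.of_forall fun τ hτ => hz τ fun h => ?_)
      rcases le_total 0 s with h1 | h1
      · rw [uIoc_of_le h1] at hτ
        linarith [hτ.2, h.1]
      · rw [uIoc_of_ge h1] at hτ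
        linarith [hτ.2, h.1]
    · have hb : b < s := by
        by_contra hb
        exact hs ⟨not_lt.1 hsa, not_lt.1 hb⟩
      have hs0 : 0 < s := lt_of_lt_of_le ha (not_lt.1 hsa)
      rw [intervalIntegral.integral_of_le hs0.le]
      refine Eq.trans ?_ h0
      refine setIntegral_eq_integral_of_forall_compl_eq_zero fun τ hτ => hz τ fun h => hτ ?_
      exact ⟨lt_of_lt_of_le ha h.1, h.2.trans hb.le⟩
  have hsupp : tsupport (fun s => ∫ τ in (0 : ℝ)..s, φ τ) ⊆ Icc a b :=
    closure_minimal (fun s hs => by_contra fun h => hs (hout s h)) isClosed_Icc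
  refine ⟨fun s => ∫ τ in (0 : ℝ)..s, φ τ, ?_, ?_, ?_, hder⟩
  · rw [contDiff_infty_iff_deriv]
    refine ⟨fun s => (hder s).differentiableAt, ?_⟩
    rwa [show deriv (fun s => ∫ τ in (0 : ℝ)..s, φ τ) = φ from funext fun s => (hder s).deriv]
  · exact isCompact_Icc.of_isClosed_subset (isClosed_tsupport _) hsupp
  · exact hsupp.trans fun s hs => lt_of_lt_of_le ha hs.1

/-- A continuous function on the half line with continuous weak derivative is differentiable. -/
theorem hasDerivAt_of_weakDeriv {A B : ℝ → ℝ} (hA : ContinuousOn A (Ioi 0))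
    (hB : ContinuousOn B (Ioi 0))
    (h : ∀ η : ℝ → ℝ, ContDiff ℝ ∞ η → HasCompactSupport η → tsupport η ⊆ Ioi 0 →
      ∫ s, (deriv η s * A s + η s * B s) = 0) {s : ℝ} (hs : 0 < s) : HasDerivAt A (B s) s := by
  -- A - C has weak derivative zero. Testing with a primitive of the difference of two unit bumps
  -- shows that its averages near any two points agree, so it is constant.
  set C : ℝ → ℝ := fun s => ∫ τ in (1 : ℝ)..s, B τ with hC
  have hCd : ∀ s, 0 < s → HasDerivAt C (B s) s := fun s hs => by
    have hsub : uIcc 1 s ⊆ Ioi 0 := fun τ hτ => lt_of_lt_of_le (lt_min one_pos hs) hτ.1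
    exact intervalIntegral.integral_hasDerivAt_right (hB.mono hsub).intervalIntegrable
      (hB.stronglyMeasurableAtFilter isOpen_Ioi s hs) (hB.continuousAt (Ioi_mem_nhds hs))
  have hCc : ContinuousOn C (Ioi 0) := fun s hs => (hCd s hs).continuousAt.continuousWithinAt
  have hcont : ∀ {v η : ℝ → ℝ}, ContinuousOn v (Ioi 0) → Continuous η → tsupport η ⊆ Ioi 0 →
      Continuous fun s => η s * v s := fun hv hη hsub => continuous_of_tsupport fun s hs =>
    hη.continuousAt.mul (hv.continuousAt (Ioi_mem_nhds (hsub (tsupport_mul_subset_left hs))))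
  have hconst : ∀ a b, 0 < a → 0 < b → A a - C a = A b - C b := by
    intro a b ha hb
    refine eq_of_forall_dist_le fun ε hε => ?_
    have hAC : ContinuousOn (fun s => A s - C s) (Ioi 0) := hA.sub hCc
    obtain ⟨φ, h1, h2, h3, h4, h5⟩ := exists_bump_integral_near ha hAC (half_pos hε)
    obtain ⟨φ', h1', h2', h3', h4', h5'⟩ := exists_bump_integral_near hb hAC (half_pos hε)
    have hi := h1.continuous.integrable_of_hasCompactSupport h2 (μ := volume)
    have hi' := h1'.continuous.integrable_of_hasCompactSupport h2' (μ := volume)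
    have hts : tsupport (fun s => φ s - φ' s) ⊆ Ioi 0 := by
      have := tsupport_sub φ φ'
      exact this.trans (union_subset h3 h3')
    obtain ⟨η, e1, e2, e3, e4⟩ := exists_primitive (φ := fun s => φ s - φ' s) (h1.sub h1')
      (h2.sub h2') hts (by rw [integral_sub hi hi', h4, h4', sub_self])
    have hη' : deriv η = fun s => φ s - φ' s := funext fun s => (e4 s).deriv
    have h6 := h η e1 e2 e3
    have hd : ∀ s, HasDerivAt (fun s => η s * C s) (deriv η s * C s + η s * B s) s := by
      intro s
      by_cases hs : s ∈ tsupport η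
      · exact ((e4 s).mul (hCd s (e3 hs))).congr_deriv (by rw [hη'])
      · have h7 : η =ᶠ[𝓝 s] fun _ => 0 := notMem_tsupport_iff_eventuallyEq.1 hs
        have h8 : (fun s => η s * C s) =ᶠ[𝓝 s] fun _ => 0 := by
          filter_upwards [h7] with r hr
          simp [hr]
        refine (h8.hasDerivAt_iff.2 (hasDerivAt_const s (0 : ℝ))).congr_deriv ?_
        rw [h7.deriv_eq, h7.self_of_nhds]
        simp
    have hts' : tsupport (deriv η) ⊆ Ioi 0 := (tsupport_deriv_subset).trans e3
    have hcd : Continuous (deriv η) := by rw [hη']; exact h1.continuous.sub h1'.continuous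
    have iA := (hcont hA hcd hts').integrable_of_hasCompactSupport e2.deriv.mul_right
      (μ := volume)
    have iC := (hcont hCc hcd hts').integrable_of_hasCompactSupport e2.deriv.mul_right
      (μ := volume)
    have iB := (hcont hB e1.continuous e3).integrable_of_hasCompactSupport e2.mul_right
      (μ := volume)
    have iηC := (hcont hCc e1.continuous e3).integrable_of_hasCompactSupport e2.mul_right
      (μ := volume)
    have h9 := integral_eq_zero_of_hasDerivAt_of_integrable hd (iC.add iB) iηC
    rw [integral_add iA iB] at h6
    rw [integral_add iC iB] at h9
    have h10 : ∫ s, deriv η s * (A s - C s) = 0 := by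
      simp_rw [mul_sub]
      rw [integral_sub iA iC]
      linarith
    simp only [hη', sub_mul] at h10
    rw [integral_sub ((hcont hAC h1.continuous h3).integrable_of_hasCompactSupport h2.mul_right)
      ((hcont hAC h1'.continuous h3').integrable_of_hasCompactSupport h2'.mul_right)] at h10
    rw [Real.dist_eq]
    rw [sub_eq_zero] at h10
    rw [h10] at h5
    rw [abs_sub_comm] at h5
    calc |A a - C a - (A b - C b)| = |(A a - C a - ∫ s, φ' s * (A s - C s)) +
          ((∫ s, φ' s * (A s - C s)) - (A b - C b))| := by ring_nf
      _ ≤ ε / 2 + ε / 2 := (abs_add_le _ _).trans (add_le_add h5 h5')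
      _ = ε := add_halves ε
  have hev : A =ᶠ[𝓝 s] fun r => C r + (A s - C s) := by
    filter_upwards [Ioi_mem_nhds hs] with r hr
    have := hconst r s hr hs
    linarith
  exact hev.hasDerivAt_iff.2 ((hCd s hs).add_const _)

end DuBoisReymond

/-! ### Mollified solutions as classical solutions -/

section Approximation

variable {n : ℕ} {ε : ℝ} {u₀ : Space n → ℝ} {u : Space n → ℝ → ℝ}

theorem continuous_nonlinearity : Continuous nonlinearity := by
  unfold nonlinearity
  fun_prop

/-- The nonlinearity is odd. This symmetry yields upper bounds from lower ones and reduces points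
outside Ω to points inside. -/
theorem IsSolution.neg (h : IsSolution ε u₀ u) :
    IsSolution ε (fun x => -u₀ x) (fun x s => -u x s) := by
  refine ⟨fun T hT => (h.memLp_top T hT).neg, fun t ht => (h.locallyIntegrable t ht).neg,
    fun ψ h1 h2 => ?_, fun φ h1 h2 h3 => ?_, ?_⟩
  · simp only [neg_mul, integral_neg]
    exact (h.continuous_distribution ψ h1 h2).neg
  · have := congrArg Neg.neg (h.equation φ h1 h2 h3)
    rw [← integral_neg, neg_zero] at this
    rw [← this]
    congr 1
    ext p
    unfold nonlinearity
    ring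
  · filter_upwards [h.initial] with x hx
    rw [hx]

theorem continuousOn_slice {v : Space n → ℝ → ℝ}
    (hv : ContinuousOn (fun p : Space n × ℝ => v p.1 p.2) (univ ×ˢ Ioi 0)) {s : ℝ} (hs : 0 < s) :
    Continuous fun y => v y s :=
  hv.comp_continuous (Continuous.prodMk_left s) fun y => ⟨mem_univ y, hs⟩

theorem continuous_mul_of_tsupport_subset {v : Space n → ℝ → ℝ}
    (hv : ContinuousOn (fun p : Space n × ℝ => v p.1 p.2) (univ ×ˢ Ioi 0))
    {χ : Space n × ℝ → ℝ} (hχ : Continuous χ) (hsub : tsupport χ ⊆ univ ×ˢ Ioi 0) :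
    Continuous fun p : Space n × ℝ => v p.1 p.2 * χ p :=
  continuous_of_tsupport fun _ hp =>
    (hv.continuousAt ((isOpen_univ.prod isOpen_Ioi).mem_nhds
      (hsub (tsupport_mul_subset_right hp)))).mul hχ.continuousAt

theorem continuousOn_integral_mul {v : Space n → ℝ → ℝ}
    (hv : ContinuousOn (fun p : Space n × ℝ => v p.1 p.2) (univ ×ˢ Ioi 0))
    {Ψ : Space n → ℝ} (hΨ : Continuous Ψ) (hc : HasCompactSupport Ψ) :
    ContinuousOn (fun s => ∫ y, v y s * Ψ y) (Ioi 0) := by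
  refine continuousOn_integral_of_compact_support hc.isCompact ?_ fun s y _ hy => ?_
  · have h1 : ContinuousOn (fun p : ℝ × Space n => v p.2 p.1) (Ioi 0 ×ˢ univ) :=
      hv.comp (f := fun p : ℝ × Space n => (p.2, p.1)) continuous_swap.continuousOn
        fun p hp => ⟨mem_univ _, hp.1⟩
    exact h1.mul (hΨ.comp continuous_snd).continuousOn
  · rw [image_eq_zero_of_notMem_tsupport hy, mul_zero]

theorem tsupport_prod_mul {Ψ : Space n → ℝ} {η : ℝ → ℝ} :
    tsupport (fun p : Space n × ℝ => Ψ p.1 * η p.2) ⊆ tsupport Ψ ×ˢ tsupport η := by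
  refine closure_minimal (fun p hp => ?_) ((isClosed_tsupport _).prod (isClosed_tsupport _))
  have hp' : Ψ p.1 * η p.2 ≠ 0 := hp
  exact ⟨subset_tsupport _ (left_ne_zero_of_mul hp'), subset_tsupport _ (right_ne_zero_of_mul hp')⟩

theorem hasCompactSupport_prod_mul {Ψ : Space n → ℝ} {η : ℝ → ℝ} (h : HasCompactSupport Ψ)
    (h' : HasCompactSupport η) : HasCompactSupport (fun p : Space n × ℝ => Ψ p.1 * η p.2) :=
  (h.isCompact.prod h'.isCompact).of_isClosed_subset (isClosed_tsupport _) tsupport_prod_mul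

/-- The weak formulation for test functions of product form. -/
theorem IsSolution.integral_prod_test (h : IsSolution ε u₀ u)
    (hcont : ContinuousOn (fun p : Space n × ℝ => u p.1 p.2) (univ ×ˢ Ioi 0))
    {Ψ : Space n → ℝ} (hΨ : ContDiff ℝ ∞ Ψ) (hΨc : HasCompactSupport Ψ)
    {η : ℝ → ℝ} (hη : ContDiff ℝ ∞ η) (hηc : HasCompactSupport η) (hηs : tsupport η ⊆ Ioi 0) :
    ∫ s, (deriv η s * (∫ y, u y s * Ψ y) + η s * ((∫ y, u y s * Laplacian.laplacian Ψ y) -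
      1 / ε ^ 2 * ∫ y, nonlinearity (u y s) * Ψ y)) = 0 := by
  have hcont' : ContinuousOn (fun p : Space n × ℝ => nonlinearity (u p.1 p.2))
      (univ ×ˢ Ioi 0) := continuous_nonlinearity.comp_continuousOn hcont
  have hΨ2 : ContDiff ℝ 2 Ψ := hΨ.of_le (by norm_cast)
  have hη' : tsupport (deriv η) ⊆ Ioi 0 := tsupport_deriv_subset.trans hηs
  have hdη : Continuous (deriv η) := hη.continuous_deriv (by norm_cast)
  have hL := continuous_laplacian hΨ
  have hLc := hasCompactSupport_laplacian hΨc
  have hsub : ∀ {χ : Space n → ℝ} {ζ : ℝ → ℝ}, tsupport ζ ⊆ Ioi 0 →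
      tsupport (fun p : Space n × ℝ => χ p.1 * ζ p.2) ⊆ univ ×ˢ Ioi 0 := fun hζ =>
    tsupport_prod_mul.trans (prod_mono (subset_univ _) hζ)
  have hint : ∀ {v : Space n → ℝ → ℝ} {χ : Space n → ℝ} {ζ : ℝ → ℝ},
      ContinuousOn (fun p : Space n × ℝ => v p.1 p.2) (univ ×ˢ Ioi 0) → Continuous χ →
      HasCompactSupport χ → Continuous ζ → HasCompactSupport ζ → tsupport ζ ⊆ Ioi 0 →
      Integrable (fun p : Space n × ℝ => v p.1 p.2 * (χ p.1 * ζ p.2)) := fun hv hχ hχc hζ hζc hζs =>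
    (continuous_mul_of_tsupport_subset hv ((hχ.comp continuous_fst).mul (hζ.comp continuous_snd))
      (hsub hζs)).integrable_of_hasCompactSupport (hasCompactSupport_prod_mul hχc hζc).mul_left
  have i1 := hint hcont hΨ.continuous hΨc hdη hηc.deriv hη'
  have i2 := hint hcont hL hLc hη.continuous hηc hηs
  have i3 := hint (v := fun y s => nonlinearity (u y s)) hcont' hΨ.continuous hΨc hη.continuous hηc hηs
  have h1 := h.equation (fun p => Ψ p.1 * η p.2)
    ((hΨ.comp contDiff_fst).mul (hη.comp contDiff_snd)) (hasCompactSupport_prod_mul hΨc hηc)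
    (hsub hηs)
  have h2 : ∀ p : Space n × ℝ, u p.1 p.2 * (deriv (fun s => Ψ p.1 * η s) p.2 +
      Laplacian.laplacian (fun y => Ψ y * η p.2) p.1) -
        1 / ε ^ 2 * nonlinearity (u p.1 p.2) * (Ψ p.1 * η p.2) =
      u p.1 p.2 * (Ψ p.1 * deriv η p.2) + u p.1 p.2 * (Laplacian.laplacian Ψ p.1 * η p.2) -
        1 / ε ^ 2 * (nonlinearity (u p.1 p.2) * (Ψ p.1 * η p.2)) := by
    intro p
    have h3 : deriv (fun s => Ψ p.1 * η s) p.2 = Ψ p.1 * deriv η p.2 :=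
      deriv_const_mul _ (hη.differentiable (by simp)).differentiableAt
    have h4 : Laplacian.laplacian (fun y => Ψ y * η p.2) p.1 =
        Laplacian.laplacian Ψ p.1 * η p.2 := by
      have h5 := InnerProductSpace.laplacian_smul (η p.2) (hΨ2.contDiffAt (x := p.1))
      rw [smul_eq_mul, mul_comm] at h5
      rw [← h5]
      have h6 : (fun y => Ψ y * η p.2) = η p.2 • Ψ := by
        ext y
        simp [mul_comm]
      rw [h6]
    rw [h3, h4]
    ring
  simp_rw [h2] at h1
  have i4 := (i1.add i2).sub (i3.const_mul (1 / ε ^ 2))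
  rw [Measure.volume_eq_prod] at h1 i4
  have h6 := integral_prod_symm _ i4
  refine Eq.trans ?_ (h6.symm.trans h1)
  refine integral_congr_ae (Eventually.of_forall fun s => ?_)
  show _ = ∫ y, (u y s * (Ψ y * deriv η s) + u y s * (Laplacian.laplacian Ψ y * η s) -
        1 / ε ^ 2 * (nonlinearity (u y s) * (Ψ y * η s)))
  by_cases hs : 0 < s
  · have hc := continuousOn_slice hcont hs
    have hc' := continuousOn_slice (v := fun y s => nonlinearity (u y s)) hcont' hs
    have j1 := integrable_mul_of_hasCompactSupport hc.locallyIntegrable hΨ.continuous hΨc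
    have j2 := integrable_mul_of_hasCompactSupport hc.locallyIntegrable hL hLc
    have j3 := integrable_mul_of_hasCompactSupport hc'.locallyIntegrable hΨ.continuous hΨc
    have e1 : ∀ y, u y s * (Ψ y * deriv η s) + u y s * (Laplacian.laplacian Ψ y * η s) -
        1 / ε ^ 2 * (nonlinearity (u y s) * (Ψ y * η s)) =
        deriv η s * (u y s * Ψ y) + η s * (u y s * Laplacian.laplacian Ψ y) -
          η s * (1 / ε ^ 2) * (nonlinearity (u y s) * Ψ y) := fun y => by ring
    simp_rw [e1]
    have j4 : Integrable fun y => deriv η s * (u y s * Ψ y) +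
        η s * (u y s * Laplacian.laplacian Ψ y) := (j1.const_mul _).add (j2.const_mul _)
    rw [integral_sub j4 (j3.const_mul _),
      integral_add (j1.const_mul _) (j2.const_mul _), integral_const_mul, integral_const_mul,
      integral_const_mul]
    ring
  · have e1 : η s = 0 := image_eq_zero_of_notMem_tsupport fun h => hs (hηs h)
    have e2 : deriv η s = 0 := image_eq_zero_of_notMem_tsupport fun h => hs (hη' h)
    simp [e1, e2]

/-- Product test functions give a weak ordinary differential equation in time for each spatial
pairing; both sides are continuous for s > 0, so it holds classically. -/
theorem IsSolution.hasDerivAt_integral (h : IsSolution ε u₀ u)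
    (hcont : ContinuousOn (fun p : Space n × ℝ => u p.1 p.2) (univ ×ˢ Ioi 0))
    {Ψ : Space n → ℝ} (hΨ : ContDiff ℝ ∞ Ψ) (hΨc : HasCompactSupport Ψ) {s : ℝ} (hs : 0 < s) :
    HasDerivAt (fun s => ∫ y, u y s * Ψ y) ((∫ y, u y s * Laplacian.laplacian Ψ y) -
      1 / ε ^ 2 * ∫ y, nonlinearity (u y s) * Ψ y) s := by
  have hcont' : ContinuousOn (fun p : Space n × ℝ => nonlinearity (u p.1 p.2))
      (univ ×ˢ Ioi 0) := continuous_nonlinearity.comp_continuousOn hcont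
  exact hasDerivAt_of_weakDeriv (continuousOn_integral_mul hcont hΨ.continuous hΨc)
    ((continuousOn_integral_mul hcont (continuous_laplacian hΨ)
      (hasCompactSupport_laplacian hΨc)).sub (continuousOn_const.mul
        (continuousOn_integral_mul hcont' hΨ.continuous hΨc)))
    (fun η h1 h2 h3 => h.integral_prod_test hcont hΨ hΨc h1 h2 h3) hs

theorem IsSolution.exists_bound (h : IsSolution ε u₀ u)
    (hcont : ContinuousOn (fun p : Space n × ℝ => u p.1 p.2) (univ ×ˢ Ioi 0)) (T : ℝ) :
    ∃ B : ℝ, ∀ x, ∀ s ∈ Ioo 0 T, |u x s| ≤ B := by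
  rcases le_or_gt T 0 with hT | hT
  · exact ⟨0, fun x s hs => absurd (hs.1.trans hs.2) (not_lt.2 hT)⟩
  set V : Set (Space n × ℝ) := univ ×ˢ Ioo 0 T with hV
  have hm := (h.memLp_top T hT).eLpNorm_lt_top
  rw [eLpNorm_exponent_top] at hm
  have h1 := ae_le_eLpNormEssSup (f := fun p : Space n × ℝ => u p.1 p.2)
    (μ := volume.restrict (univ ×ˢ Icc 0 T))
  have h2 : ∀ᵐ p : Space n × ℝ ∂(volume.restrict V), ‖u p.1 p.2‖ₑ ≤
      eLpNormEssSup (fun p : Space n × ℝ => u p.1 p.2) (volume.restrict (univ ×ˢ Icc 0 T)) :=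
    ae_restrict_of_ae_restrict_of_subset (prod_mono le_rfl Ioo_subset_Icc_self) h1
  set B := (eLpNormEssSup (fun p : Space n × ℝ => u p.1 p.2)
    (volume.restrict (univ ×ˢ Icc 0 T))).toReal with hB
  -- The excess of |u| over its essential bound is continuous and vanishes almost everywhere on an
  -- open set, so it vanishes everywhere there.
  have h3 : (fun p : Space n × ℝ => max (|u p.1 p.2| - B) 0) =ᵐ[volume.restrict V]
      fun _ => (0 : ℝ) := by
    filter_upwards [h2] with p hp
    have h4 := ENNReal.toReal_mono hm.ne hp
    rw [toReal_enorm, Real.norm_eq_abs] at h4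
    exact max_eq_right (sub_nonpos.2 h4)
  have hVs : V ⊆ univ ×ˢ Ioi 0 := prod_mono le_rfl Ioo_subset_Ioi_self
  have h5 := Measure.eqOn_open_of_ae_eq h3 (isOpen_univ.prod isOpen_Ioo)
    (((hcont.mono hVs).abs.sub continuousOn_const).sup continuousOn_const) continuousOn_const
  refine ⟨B, fun x s hs => ?_⟩
  have h6 := h5 (show (x, s) ∈ V from ⟨mem_univ _, hs⟩)
  exact sub_nonpos.1 (max_eq_right_iff.1 h6)

/-- The spatial mollifications of a solution solve mollified equations classically. -/
theorem IsSolution.classicalHeat_mollify (h : IsSolution ε u₀ u)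
    (hcont : ContinuousOn (fun p : Space n × ℝ => u p.1 p.2) (univ ×ˢ Ioi 0))
    {ψ : Space n → ℝ} (hψ : ContDiff ℝ ∞ ψ) (hc : HasCompactSupport ψ)
    (hcw : ContinuousOn (fun p : Space n × ℝ => mollify (fun y => u y p.2) ψ p.1)
      (univ ×ˢ Ioi 0)) :
    ClassicalHeat (univ ×ˢ Ioi 0) (fun x s => mollify (fun y => u y s) ψ x)
      (fun x s => -(1 / ε ^ 2) * mollify (fun y => nonlinearity (u y s)) ψ x) := by
  refine ⟨hcw, fun p hp => ⟨_, hasLaplacianAt_mollify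
    (continuousOn_slice hcont hp.2).locallyIntegrable hψ hc p.1, ?_⟩⟩
  have h1 := h.hasDerivAt_integral hcont (Ψ := fun y => ψ (p.1 - y))
    (hψ.comp (contDiff_const.sub contDiff_id)) (HasCompactSupport.comp_const_sub hc p.1) hp.2
  refine h1.congr_deriv ?_
  simp_rw [laplacian_comp_const_sub (hψ.of_le (by norm_cast)) p.1]
  simp only [mollify]
  ring

/-- Mollifications of a function of space and time are jointly continuous, given continuity
in time in the sense of distributions and slicewise bounds. -/
theorem continuousOn_mollify {v : Space n → ℝ → ℝ} {J : Set ℝ} {B : ℝ}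
    (hloc : ∀ s ∈ J, LocallyIntegrable fun y => v y s) (hB : ∀ s ∈ J, ∀ᵐ y, |v y s| ≤ B)
    (hdist : ∀ ψ : Space n → ℝ, ContDiff ℝ ∞ ψ → HasCompactSupport ψ →
      ContinuousOn (fun s : ℝ => ∫ x, v x s * ψ x) J)
    {ψ : Space n → ℝ} (hψ : ContDiff ℝ ∞ ψ) (hc : HasCompactSupport ψ) :
    ContinuousOn (fun p : Space n × ℝ => mollify (fun y => v y p.2) ψ p.1) (univ ×ˢ J) := by
  rintro ⟨x₀, s₀⟩ ⟨-, hs₀⟩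
  have hB0 : ∀ s ∈ J, 0 ≤ B := fun s hs =>
    (hB s hs).exists.elim fun y hy => (abs_nonneg _).trans hy
  -- The increment is split in two: moving x at fixed time costs at most B times the L¹ distance D
  -- of translated kernels, and moving the time at fixed x₀ is continuity in distributions.
  set D : Space n → ℝ := fun x => ∫ y, |ψ (x - y) - ψ (x₀ - y)| with hD
  have hcs : ∀ x, Continuous fun y => ψ (x - y) := fun x => hψ.continuous.comp (by fun_prop)
  have hDc : ContinuousAt D x₀ := by
    obtain ⟨R, hR⟩ := hc.isCompact.isBounded.subset_closedBall (0 : Space n)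
    have hz : ∀ z, R < ‖z‖ → ψ z = 0 := fun z hz => image_eq_zero_of_notMem_tsupport fun h => by
      have := mem_closedBall_zero_iff.1 (hR h)
      linarith
    have h1 : ContinuousOn D (Metric.closedBall x₀ 1) := by
      refine continuousOn_integral_of_compact_support
        (isCompact_closedBall x₀ (|R| + 1)) ?_ fun x y hx hy => ?_
      · apply Continuous.continuousOn
        have := hψ.continuous
        unfold Function.uncurry
        fun_prop
      · rw [mem_closedBall_iff_norm] at hx
        rw [mem_closedBall_iff_norm, not_le] at hy
        have h2 : ‖y - x₀‖ ≤ ‖x - y‖ + ‖x - x₀‖ := by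
          have := norm_sub_le (x - x₀) (x - y)
          rw [sub_sub_sub_cancel_left] at this
          linarith
        rw [hz, hz, sub_zero, abs_zero]
        · rw [norm_sub_rev]; linarith [le_abs_self R]
        · linarith [le_abs_self R]
    exact h1.continuousAt (Metric.closedBall_mem_nhds x₀ one_pos)
  have hD0 : D x₀ = 0 := by simp [hD]
  have h1 : Tendsto (fun p : Space n × ℝ => B * D p.1 +
      |mollify (fun y => v y p.2) ψ x₀ - mollify (fun y => v y s₀) ψ x₀|)
      (𝓝[univ ×ˢ J] (x₀, s₀)) (𝓝 0) := by
    have h2 : Tendsto (fun p : Space n × ℝ => D p.1) (𝓝[univ ×ˢ J] (x₀, s₀)) (𝓝 0) := by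
      rw [← hD0]
      exact (hDc.tendsto.comp continuous_fst.continuousAt.tendsto).mono_left nhdsWithin_le_nhds
    have h3 : Tendsto (fun p : Space n × ℝ => mollify (fun y => v y p.2) ψ x₀)
        (𝓝[univ ×ˢ J] (x₀, s₀)) (𝓝 (mollify (fun y => v y s₀) ψ x₀)) := by
      have h4 := hdist (fun y => ψ (x₀ - y)) (hψ.comp (contDiff_const.sub contDiff_id))
        (HasCompactSupport.comp_const_sub hc x₀) s₀ hs₀
      exact h4.tendsto.comp (f := fun p : Space n × ℝ => p.2)
        (tendsto_nhdsWithin_iff.2 ⟨continuous_snd.continuousAt.tendsto.mono_left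
        nhdsWithin_le_nhds, eventually_mem_nhdsWithin.mono fun p hp => hp.2⟩)
    simpa using (h2.const_mul B).add (h3.sub_const (mollify (fun y => v y s₀) ψ x₀)).abs
  rw [ContinuousWithinAt, tendsto_iff_dist_tendsto_zero]
  refine squeeze_zero' (Eventually.of_forall fun _ => dist_nonneg) ?_ h1
  filter_upwards [self_mem_nhdsWithin] with p hp
  have hi := fun x => integrable_mul_of_hasCompactSupport (hloc p.2 hp.2) (hcs x)
    (HasCompactSupport.comp_const_sub hc x)
  have h5 : |mollify (fun y => v y p.2) ψ p.1 - mollify (fun y => v y p.2) ψ x₀| ≤ B * D p.1 := by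
    simp only [mollify, hD]
    rw [← integral_sub (hi _) (hi _), ← integral_const_mul, ← Real.norm_eq_abs]
    refine norm_integral_le_of_norm_le ?_ ?_
    · exact (((((hcs p.1).integrable_of_hasCompactSupport
        (HasCompactSupport.comp_const_sub hc _)).sub ((hcs x₀).integrable_of_hasCompactSupport
        (HasCompactSupport.comp_const_sub hc _)))).abs).const_mul B
    · filter_upwards [hB p.2 hp.2] with y hy
      rw [← mul_sub, norm_mul, Real.norm_eq_abs, Real.norm_eq_abs]
      exact mul_le_mul_of_nonneg_right hy (abs_nonneg _)
  rw [Real.dist_eq]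
  calc |mollify (fun y => v y p.2) ψ p.1 - mollify (fun y => v y s₀) ψ x₀| =
      |(mollify (fun y => v y p.2) ψ p.1 - mollify (fun y => v y p.2) ψ x₀) +
        (mollify (fun y => v y p.2) ψ x₀ - mollify (fun y => v y s₀) ψ x₀)| := by ring_nf
    _ ≤ _ := (abs_add_le _ _).trans (add_le_add_left h5 _)

/-- A sequence of mollifiers, with supports in the balls of radius `1 / (k + 1)`. -/
def mollifier (n k : ℕ) : ContDiffBump (0 : Space n) where
  rIn := 1 / (2 * ((k : ℝ) + 1))
  rOut := 1 / ((k : ℝ) + 1)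
  rIn_pos := by positivity
  rIn_lt_rOut := by
    apply one_div_lt_one_div_of_lt <;> linarith [(Nat.cast_nonneg k : (0 : ℝ) ≤ k)]

/-- The kernel of the `k`-th mollifier. -/
abbrev mollifierKernel (n k : ℕ) : Space n → ℝ := (mollifier n k).normed volume

theorem mollify_mollifierKernel_eq (g : Space n → ℝ) (k : ℕ) (x : Space n) :
    mollify g (mollifierKernel n k) x =
      convolution (mollifierKernel n k) g (ContinuousLinearMap.lsmul ℝ ℝ) volume x := by
  simp only [mollify, convolution, ContinuousLinearMap.lsmul_apply, smul_eq_mul]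
  rw [← integral_sub_left_eq_self _ volume x]
  simp [mul_comm]

theorem tendstoUniformlyOn_mollify {v : Space n → ℝ → ℝ}
    (hv : ContinuousOn (fun p : Space n × ℝ => v p.1 p.2) (univ ×ˢ Ioi 0))
    {K : Set (Space n × ℝ)} (hK : K ⊆ univ ×ˢ Ioi 0) (hKc : IsCompact K) :
    TendstoUniformlyOn (fun k (p : Space n × ℝ) =>
      mollify (fun y => v y p.2) (mollifierKernel n k) p.1) (fun p => v p.1 p.2) atTop K := by
  rw [Metric.tendstoUniformlyOn_iff]
  intro e he
  -- The spatial 1-neighbourhood of K contains every point seen by the kernels and is compact, so v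
  -- is uniformly continuous on it.
  set K' : Set (Space n × ℝ) := (fun q : (Space n × ℝ) × Space n => (q.1.1 + q.2, q.1.2)) ''
    (K ×ˢ Metric.closedBall 0 1) with hK'
  have hK'c : IsCompact K' := (hKc.prod (isCompact_closedBall 0 1)).image (by fun_prop)
  have hK's : K' ⊆ univ ×ˢ Ioi 0 := by
    rintro _ ⟨q, hq, rfl⟩
    exact ⟨mem_univ _, (hK hq.1).2⟩
  have huc := hK'c.uniformContinuousOn_of_continuous (hv.mono hK's)
  rw [Metric.uniformContinuousOn_iff] at huc
  obtain ⟨δ, hδ, hδv⟩ := huc (e / 2) (half_pos he)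
  have hk : ∀ᶠ k : ℕ in atTop, 1 / ((k : ℝ) + 1) < δ :=
    tendsto_one_div_add_atTop_nhds_zero_nat.eventually (gt_mem_nhds hδ)
  filter_upwards [hk] with k hk p hp
  have hk1 : 1 / ((k : ℝ) + 1) ≤ 1 := by
    rw [div_le_one (by positivity)]
    linarith [(Nat.cast_nonneg k : (0 : ℝ) ≤ k)]
  rw [mollify_mollifierKernel_eq, dist_comm]
  refine lt_of_le_of_lt ((mollifier n k).dist_normed_convolution_le (ε := e / 2)
    (continuousOn_slice hv (hK hp).2).aestronglyMeasurable fun y hy => ?_) (half_lt_self he)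
  have hy' : dist y p.1 < 1 / ((k : ℝ) + 1) := hy
  refine (hδv (y, p.2) ⟨(p, y - p.1), ⟨hp, ?_⟩, by simp⟩ p ⟨(p, 0), ⟨hp, by simp⟩, by simp⟩
    ?_).le
  · rw [mem_closedBall_zero_iff, ← dist_eq_norm]
    linarith
  · rw [Prod.dist_eq]
    simpa using hy'.trans hk

/-- The kernel is a probability density supported within distance 1 / (k + 1), so a local
almost-everywhere lower bound survives averaging. -/
theorem le_mollify_mollifierKernel {g : Space n → ℝ} (hg : LocallyIntegrable g) {a : ℝ} {k : ℕ}
    {x : Space n} (h : ∀ᵐ y, dist y x < 1 / ((k : ℝ) + 1) → a ≤ g y) :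
    a ≤ mollify g (mollifierKernel n k) x := by
  have hi := integrable_mul_of_hasCompactSupport hg
    ((mollifier n k).continuous_normed.comp (by fun_prop : Continuous fun y => x - y))
    (HasCompactSupport.comp_const_sub (mollifier n k).hasCompactSupport_normed x)
    (ψ := fun y => mollifierKernel n k (x - y))
  have h1 : ∫ y, mollifierKernel n k (x - y) = 1 := by
    rw [integral_sub_left_eq_self (fun y => mollifierKernel n k y) volume x]
    exact (mollifier n k).integral_normed
  have hi' : Integrable fun y => a * mollifierKernel n k (x - y) :=
    ((mollifier n k).integrable_normed.comp_sub_left x).const_mul a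
  calc a = ∫ y, a * mollifierKernel n k (x - y) := by rw [integral_const_mul, h1, mul_one]
    _ ≤ _ := integral_mono_ae hi' hi ?_
  filter_upwards [h] with y hy
  by_cases hd : dist y x < 1 / ((k : ℝ) + 1)
  · exact mul_le_mul_of_nonneg_right (hy hd) ((mollifier n k).nonneg_normed _)
  · have : mollifierKernel n k (x - y) = 0 := by
      have hs := (mollifier n k).support_normed_eq (μ := volume)
      by_contra hne
      have : x - y ∈ Function.support (mollifierKernel n k) := hne
      rw [hs, mem_ball_zero_iff, ← dist_eq_norm, dist_comm] at this
      exact hd this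
    simp [this]

end Approximation

/-! ### Bounds, attainment of the datum and differentiability -/

section Regularity

variable {n : ℕ} {ε : ℝ} {u₀ : Space n → ℝ} {u : Space n → ℝ → ℝ}

theorem IsSolution.exists_slice_bound (h : IsSolution ε u₀ u) (h₀ : ∀ x, |u₀ x| ≤ 1)
    (hcont : ContinuousOn (fun p : Space n × ℝ => u p.1 p.2) (univ ×ˢ Ioi 0)) (T : ℝ) :
    ∃ B : ℝ, 0 ≤ B ∧ (∀ x, ∀ s ∈ Ioo 0 T, |u x s| ≤ B) ∧
      ∀ s ∈ Ico 0 T, ∀ᵐ x, |u x s| ≤ B := by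
  obtain ⟨B, hB⟩ := h.exists_bound hcont T
  refine ⟨max B 1, by positivity, fun x s hs => (hB x s hs).trans (le_max_left _ _),
    fun s hs => ?_⟩
  rcases hs.1.eq_or_lt with rfl | h1
  · filter_upwards [h.initial] with x hx
    rw [hx]
    exact (h₀ x).trans (le_max_right _ _)
  · exact Eventually.of_forall fun x => (hB x s ⟨h1, hs.2⟩).trans (le_max_left _ _)

/-- Time 0 is included: this is where continuity into distributions enters, and it lets comparison
arguments start from the datum. The bounds on u are local in time, hence the localisation to `Ico 0
(p.2 + 1)`. -/
theorem IsSolution.continuousOn_mollify (h : IsSolution ε u₀ u) (h₀ : ∀ x, |u₀ x| ≤ 1)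
    (hcont : ContinuousOn (fun p : Space n × ℝ => u p.1 p.2) (univ ×ˢ Ioi 0))
    {ψ : Space n → ℝ} (hψ : ContDiff ℝ ∞ ψ) (hc : HasCompactSupport ψ) :
    ContinuousOn (fun p : Space n × ℝ => mollify (fun y => u y p.2) ψ p.1) (univ ×ˢ Ici 0) := by
  intro p hp
  obtain ⟨B, -, -, hB⟩ := h.exists_slice_bound h₀ hcont (p.2 + 1)
  have h1 := AllenCahn.continuousOn_mollify (J := Ico 0 (p.2 + 1))
    (fun s hs => h.locallyIntegrable s hs.1) hB
    (fun ψ h1 h2 => (h.continuous_distribution ψ h1 h2).mono Ico_subset_Ici_self) hψ hc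
  have h2 : p ∈ (univ : Set (Space n)) ×ˢ Ico 0 (p.2 + 1) :=
    ⟨mem_univ _, hp.2, lt_add_one p.2⟩
  refine (h1 p h2).mono_of_mem_nhdsWithin ?_
  have h3 : (univ : Set (Space n)) ×ˢ Iio (p.2 + 1) ∈ 𝓝 p :=
    (isOpen_univ.prod isOpen_Iio).mem_nhds ⟨mem_univ _, lt_add_one p.2⟩
  filter_upwards [self_mem_nhdsWithin, mem_nhdsWithin_of_mem_nhds h3] with q hq hq'
  exact ⟨mem_univ _, hq.2, hq'.2⟩

theorem IsSolution.classicalHeat_mollifier (h : IsSolution ε u₀ u) (h₀ : ∀ x, |u₀ x| ≤ 1)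
    (hcont : ContinuousOn (fun p : Space n × ℝ => u p.1 p.2) (univ ×ˢ Ioi 0)) (k : ℕ) :
    ClassicalHeat (univ ×ˢ Ioi 0) (fun x s => mollify (fun y => u y s) (mollifierKernel n k) x)
      (fun x s => -(1 / ε ^ 2) *
        mollify (fun y => nonlinearity (u y s)) (mollifierKernel n k) x) :=
  h.classicalHeat_mollify hcont (mollifier n k).contDiff_normed
    (mollifier n k).hasCompactSupport_normed
    ((h.continuousOn_mollify h₀ hcont (mollifier n k).contDiff_normed
      (mollifier n k).hasCompactSupport_normed).mono (prod_mono le_rfl Ioi_subset_Ici_self))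

theorem IsSolution.tendstoUniformlyOn_mollifier
    (hcont : ContinuousOn (fun p : Space n × ℝ => u p.1 p.2) (univ ×ˢ Ioi 0))
    {K : Set (Space n × ℝ)} (hK : K ⊆ univ ×ˢ Ioi 0) (hKc : IsCompact K) :
    TendstoUniformlyOn (fun k (p : Space n × ℝ) =>
      mollify (fun y => u y p.2) (mollifierKernel n k) p.1) (fun p => u p.1 p.2) atTop K ∧
    TendstoUniformlyOn (fun k (p : Space n × ℝ) => -(1 / ε ^ 2) *
      mollify (fun y => nonlinearity (u y p.2)) (mollifierKernel n k) p.1)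
      (fun p => -(1 / ε ^ 2) * nonlinearity (u p.1 p.2)) atTop K :=
  ⟨tendstoUniformlyOn_mollify hcont hK hKc,
    tendstoUniformlyOn_time_mul (a := fun _ => -(1 / ε ^ 2)) continuous_const hKc
      (w := fun x s => nonlinearity (u x s))
      (W := fun k x s => mollify (fun y => nonlinearity (u y s)) (mollifierKernel n k) x)
      (tendstoUniformlyOn_mollify (v := fun x s => nonlinearity (u x s))
        (continuous_nonlinearity.comp_continuousOn hcont) hK hKc)⟩

theorem IsSolution.heatLimit (h : IsSolution ε u₀ u) (h₀ : ∀ x, |u₀ x| ≤ 1)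
    (hcont : ContinuousOn (fun p : Space n × ℝ => u p.1 p.2) (univ ×ˢ Ioi 0)) :
    HeatLimit (univ ×ˢ Ioi 0) u (fun x s => -(1 / ε ^ 2) * nonlinearity (u x s)) :=
  ⟨hcont, _, _, h.classicalHeat_mollifier h₀ hcont,
    fun _ hK hKc => tendstoUniformlyOn_mollifier hcont hK hKc⟩

theorem IsSolution.differentiableAt (h : IsSolution ε u₀ u) (h₀ : ∀ x, |u₀ x| ≤ 1)
    (hcont : ContinuousOn (fun p : Space n × ℝ => u p.1 p.2) (univ ×ˢ Ioi 0)) {t : ℝ}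
    (ht : 0 < t) (x : Space n) : DifferentiableAt ℝ (fun y => u y t) x :=
  differentiableAt_of_tendsto (F := fun x s => -(1 / ε ^ 2) * nonlinearity (u x s))
    (h.classicalHeat_mollifier h₀ hcont)
    (fun k s hs => (contDiff_mollify (continuousOn_slice hcont hs).locallyIntegrable
      (mollifier n k).contDiff_normed
      (mollifier n k).hasCompactSupport_normed).differentiable (by simp))
    (fun _ hK hKc => tendstoUniformlyOn_mollifier hcont hK hKc) ht x

/-- Since ‖x - y‖² + 2(n + 1)s solves the heat equation, only the term -cs leaves a source. -/
theorem classicalHeat_quadratic (y : Space n) (a b c : ℝ) (D : Set (Space n × ℝ)) :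
    ClassicalHeat D (fun x s => a - b * (‖x - y‖ ^ 2 + 2 * (n + 1) * s) - c * s)
      (fun _ _ => -c) := by
  refine ⟨Continuous.continuousOn (by fun_prop), fun p _ => ⟨-b * (2 * (n + 1)), ?_, ?_⟩⟩
  · have := ((HasLaplacianAt.norm_sub_sq y p.1).const_mul (-b)).add
      (HasLaplacianAt.const (x := p.1) (a - b * (2 * (n + 1) * p.2) - c * p.2))
    rw [add_zero] at this
    convert this using 2 with x
    ring
  · refine ((((((hasDerivAt_id p.2).const_mul (2 * ((n : ℝ) + 1))).const_add
      (‖p.1 - y‖ ^ 2)).const_mul b).const_sub a).sub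
        ((hasDerivAt_id p.2).const_mul c)).congr_deriv ?_
    ring

theorem abs_nonlinearity_le {r B : ℝ} (h : |r| ≤ B) : |nonlinearity r| ≤ 2 * B * (B ^ 2 + 1) := by
  unfold nonlinearity
  have hB := (abs_nonneg r).trans h
  rw [abs_mul, abs_mul, abs_two]
  have h1 : |r ^ 2 - 1| ≤ B ^ 2 + 1 := by
    have := pow_le_pow_left₀ (abs_nonneg r) h 2
    rw [sq_abs] at this
    rw [abs_le]
    constructor <;> nlinarith [sq_nonneg r]
  exact mul_le_mul (by linarith) h1 (abs_nonneg _) (by positivity)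

/-- A lower bound for mollified solutions, by comparison with a quadratic polynomial. -/
theorem IsSolution.le_mollify (h : IsSolution ε u₀ u) (h₀ : ∀ x, |u₀ x| ≤ 1)
    (hcont : ContinuousOn (fun p : Space n × ℝ => u p.1 p.2) (univ ×ˢ Ioi 0)) {T B : ℝ}
    (hB : ∀ x, ∀ s ∈ Ioo 0 T, |u x s| ≤ B) (hB' : ∀ s ∈ Ico 0 T, ∀ᵐ x, |u x s| ≤ B) {k : ℕ}
    {y : Space n} {a b : ℝ} (hb : 0 < b)
    (hinit : ∀ x, a - b * ‖x - y‖ ^ 2 ≤ mollify (fun y => u y 0) (mollifierKernel n k) x)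
    {s : ℝ} (hs : s ∈ Ioo 0 T) :
    a - b * (2 * (n + 1) * s) - 1 / ε ^ 2 * (2 * B * (B ^ 2 + 1)) * s ≤
      mollify (fun y => u y s) (mollifierKernel n k) y := by
  set L := 2 * B * (B ^ 2 + 1) with hL
  have hB0 : 0 ≤ B := (abs_nonneg _).trans (hB y s hs)
  have hL0 : 0 ≤ 1 / ε ^ 2 * L := by positivity
  -- At distance R from y the quadratic is at most -B, below every mollified value; this replaces
  -- decay at infinity.
  set R := √((|a| + B) / b) + 1 with hR
  have hR0 : 0 < R := by positivity
  have hR2 : |a| + B ≤ b * R ^ 2 := by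
    have h1 : (|a| + B) / b ≤ R ^ 2 := by
      have h2 := Real.sq_sqrt (by positivity : 0 ≤ (|a| + B) / b)
      have h3 := Real.sqrt_nonneg ((|a| + B) / b)
      nlinarith
    rw [div_le_iff₀ hb] at h1
    linarith
  have hle : ∀ x, ∀ r ∈ Ico 0 T, -B ≤ mollify (fun y => u y r) (mollifierKernel n k) x := by
    intro x r hr
    refine le_mollify_mollifierKernel (h.locallyIntegrable r hr.1) ?_
    filter_upwards [hB' r hr] with z hz _ using (abs_le.1 hz).1
  have hIcc : Icc 0 s ⊆ Ico 0 T := fun r hr => ⟨hr.1, hr.2.trans_lt hs.2⟩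
  have hsub : (Metric.ball y R) ×ˢ Ioc 0 s ⊆ univ ×ˢ Ioi 0 :=
    prod_mono (subset_univ _) Ioc_subset_Ioi_self
  have hheat := ((classicalHeat_quadratic y a b (1 / ε ^ 2 * L) univ).mono
    (subset_univ (Metric.ball y R ×ˢ Ioc 0 s))).sub
      ((h.classicalHeat_mollifier h₀ hcont k).mono hsub)
  have key := hheat.heatLimit.nonpos (isCompact_closedBall y R) Metric.isOpen_ball
    Metric.ball_subset_closedBall ?_ ?_ ?_ 0 ?_ y (Metric.mem_closedBall_self hR0.le) s
    ⟨hs.1.le, le_rfl⟩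
  · simp only [sub_self, norm_zero] at key
    linarith
  · refine ContinuousOn.sub (Continuous.continuousOn (by fun_prop)) ?_
    exact (h.continuousOn_mollify h₀ hcont (mollifier n k).contDiff_normed
      (mollifier n k).hasCompactSupport_normed).mono (prod_mono (subset_univ _) Icc_subset_Ici_self)
  · rintro x ⟨-, hx⟩ r hr
    rw [mem_ball_iff_norm, not_lt] at hx
    have h1 := hle x r (hIcc hr)
    have h2 : b * R ^ 2 ≤ b * ‖x - y‖ ^ 2 := by gcongr
    have h3 : 0 ≤ b * (2 * (n + 1) * r) :=
      mul_nonneg hb.le (mul_nonneg (by positivity) hr.1)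
    have h4 := mul_nonneg hL0 hr.1
    linarith [le_abs_self a]
  · intro x _
    have := hinit x
    linarith
  · intro x _ r hr _
    have hr' : 0 < r := hr.1
    have h1 : -L ≤ mollify (fun y => -nonlinearity (u y r)) (mollifierKernel n k) x := by
      refine le_mollify_mollifierKernel ?_ (Eventually.of_forall fun z _ => ?_)
      · exact (continuous_nonlinearity.comp (continuousOn_slice hcont hr')).neg.locallyIntegrable
      · have := abs_le.1 (abs_nonlinearity_le (hB z r ⟨hr', hr.2.trans_lt hs.2⟩))
        linarith [this.2]
    have h2 : mollify (fun y => -nonlinearity (u y r)) (mollifierKernel n k) x =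
        -mollify (fun y => nonlinearity (u y r)) (mollifierKernel n k) x := by
      simp [mollify, integral_neg]
    rw [h2] at h1
    have h3 : 1 / ε ^ 2 * mollify (fun y => nonlinearity (u y r)) (mollifierKernel n k) x ≤
        1 / ε ^ 2 * L := mul_le_mul_of_nonneg_left (by linarith) (by positivity)
    linarith

theorem tendsto_mollify_mollifier
    (hcont : ContinuousOn (fun p : Space n × ℝ => u p.1 p.2) (univ ×ˢ Ioi 0)) (y : Space n)
    {s : ℝ} (hs : 0 < s) :
    Tendsto (fun k => mollify (fun y => u y s) (mollifierKernel n k) y) atTop (𝓝 (u y s)) :=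
  (tendstoUniformlyOn_mollify hcont (singleton_subset_iff.2 ⟨mem_univ y, hs⟩ :
    {(y, s)} ⊆ univ ×ˢ Ioi 0) isCompact_singleton).tendsto_at (mem_singleton (y, s))

/-- Letting b tend to 0 in the quadratic comparison leaves -1 and the crude source bound, which is
sharp enough only for small s. -/
theorem IsSolution.neg_one_sub_le (h : IsSolution ε u₀ u) (h₀ : ∀ x, |u₀ x| ≤ 1)
    (hcont : ContinuousOn (fun p : Space n × ℝ => u p.1 p.2) (univ ×ˢ Ioi 0)) {T B : ℝ}
    (hB : ∀ x, ∀ s ∈ Ioo 0 T, |u x s| ≤ B) (hB' : ∀ s ∈ Ico 0 T, ∀ᵐ x, |u x s| ≤ B)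
    {s : ℝ} (hs : s ∈ Ioo 0 T) (y : Space n) :
    -1 - 1 / ε ^ 2 * (2 * B * (B ^ 2 + 1)) * s ≤ u y s := by
  have h1 : ∀ b > 0, -1 - b * (2 * (n + 1) * s) - 1 / ε ^ 2 * (2 * B * (B ^ 2 + 1)) * s ≤
      u y s := fun b hb => by
    refine ge_of_tendsto (tendsto_mollify_mollifier hcont y hs.1) (Eventually.of_forall fun k =>
      h.le_mollify h₀ hcont hB hB' hb (fun x => ?_) hs)
    have : -1 ≤ mollify (fun y => u y 0) (mollifierKernel n k) x := by
      refine le_mollify_mollifierKernel (h.locallyIntegrable 0 le_rfl) ?_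
      filter_upwards [h.initial] with z hz _
      rw [hz]
      exact (abs_le.1 (h₀ z)).1
    have h2 : 0 ≤ b * ‖x - y‖ ^ 2 := by positivity
    linarith
  have h2 : Tendsto (fun b : ℝ => -1 - b * (2 * (n + 1) * s) -
      1 / ε ^ 2 * (2 * B * (B ^ 2 + 1)) * s) (𝓝[>] 0)
      (𝓝 (-1 - 0 * (2 * (n + 1) * s) - 1 / ε ^ 2 * (2 * B * (B ^ 2 + 1)) * s)) := by
    refine Tendsto.mono_left (Continuous.tendsto (by fun_prop) 0) nhdsWithin_le_nhds
  have h3 := le_of_tendsto h2 (eventually_mem_nhdsWithin.mono fun b hb => h1 b hb)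
  linarith

/-- The comparison is restarted at a small time s₁, when u is almost at least -1. Below -1 the
reaction pushes u upwards, so nothing further is lost to it; then s₁ tends to 0. -/
theorem IsSolution.neg_one_le (h : IsSolution ε u₀ u) (h₀ : ∀ x, |u₀ x| ≤ 1)
    (hcont : ContinuousOn (fun p : Space n × ℝ => u p.1 p.2) (univ ×ˢ Ioi 0))
    {t : ℝ} (ht : 0 < t) (y : Space n) : -1 ≤ u y t := by
  obtain ⟨B, hB0, hB, hB'⟩ := h.exists_slice_bound h₀ hcont (t + 1)
  set c := 1 / ε ^ 2 * (2 * B * (B ^ 2 + 1)) with hc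
  have hc0 : 0 ≤ c := by positivity
  have key : ∀ s₁ ∈ Ioo 0 t, -1 - c * s₁ - s₁ * (2 * (n + 1) * t) ≤ u y t := by
    intro s₁ hs₁
    -- The quadratic coefficient is also taken to be s₁, so that a single limit removes both errors.
    set R := √(B / s₁) + 1 with hR
    have hR0 : 0 < R := by positivity
    have hs₁0 : 0 < s₁ := hs₁.1
    have hR2 : B ≤ s₁ * R ^ 2 := by
      have h1 : B / s₁ ≤ R ^ 2 := by
        have h2 := Real.sq_sqrt (by positivity : 0 ≤ B / s₁)
        have h3 := Real.sqrt_nonneg (B / s₁)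
        nlinarith
      rw [div_le_iff₀ hs₁0] at h1
      linarith
    have hsub : (Metric.ball y R) ×ˢ Ioc s₁ t ⊆ univ ×ˢ Ioi 0 :=
      prod_mono (subset_univ _) fun r hr => hs₁0.trans hr.1
    have hcs := mul_nonneg hc0 hs₁0.le
    have hheat := (classicalHeat_quadratic y (-1 - c * s₁) s₁ 0
      (Metric.ball y R ×ˢ Ioc s₁ t)).heatLimit.sub ((h.heatLimit h₀ hcont).mono hsub)
    have := hheat.nonpos (isCompact_closedBall y R) Metric.isOpen_ball
      Metric.ball_subset_closedBall ?_ ?_ ?_ 0 ?_ y (Metric.mem_closedBall_self hR0.le) t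
      ⟨hs₁.2.le, le_rfl⟩
    · simp only [sub_self, norm_zero] at this
      linarith
    · refine ContinuousOn.sub (Continuous.continuousOn (by fun_prop)) (hcont.mono ?_)
      exact prod_mono (subset_univ _) fun r hr => hs₁0.trans_le hr.1
    · rintro x ⟨-, hx⟩ r hr
      rw [mem_ball_iff_norm, not_lt] at hx
      have hr0 : 0 < r := hs₁0.trans_le hr.1
      have h1 := (abs_le.1 (hB x r ⟨hr0, by linarith [hr.2]⟩)).1
      have h2 : s₁ * R ^ 2 ≤ s₁ * ‖x - y‖ ^ 2 := by gcongr
      have h3 : 0 ≤ s₁ * (2 * (n + 1) * r) := by positivity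
      linarith
    · intro x _
      have h1 := h.neg_one_sub_le h₀ hcont hB hB' ⟨hs₁0, by linarith [hs₁.2]⟩ x
      have h3 : 0 ≤ s₁ * (‖x - y‖ ^ 2 + 2 * (n + 1) * s₁) := by positivity
      linarith
    · intro x _ r hr hpos
      have hr0 : 0 < r := hs₁0.trans hr.1
      have h3 : 0 ≤ s₁ * (‖x - y‖ ^ 2 + 2 * (n + 1) * r) := by positivity
      have h4 : u x r < -1 := by linarith
      have h5 : nonlinearity (u x r) ≤ 0 := by
        unfold nonlinearity
        exact mul_nonpos_of_nonpos_of_nonneg (by linarith) (by nlinarith)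
      have h6 := mul_nonpos_of_nonneg_of_nonpos (by positivity : 0 ≤ 1 / ε ^ 2) h5
      linarith
  have h2 : Tendsto (fun b : ℝ => -1 - c * b - b * (2 * (n + 1) * t)) (𝓝[>] 0)
      (𝓝 (-1 - c * 0 - 0 * (2 * (n + 1) * t))) :=
    Tendsto.mono_left (Continuous.tendsto (by fun_prop) 0) nhdsWithin_le_nhds
  have h3 := le_of_tendsto h2 (mem_of_superset (Ioo_mem_nhdsGT ht) key)
  linarith

/-- The properties of a solution with initial datum `u₀` that are used in the barrier argument;
`lam` stands for `ε⁻²`. -/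
structure BoundedFlow (lam : ℝ) (u₀ : Space n → ℝ) (u : Space n → ℝ → ℝ) : Prop where
  heatLimit : HeatLimit (univ ×ˢ Ioi 0) u (fun x s => -lam * nonlinearity (u x s))
  abs_le_one : ∀ x s, 0 < s → |u x s| ≤ 1
  initial : ∃ c : ℝ, 0 < c ∧ ∀ y η, 0 < η → (∀ x ∈ Metric.ball y η, u₀ x = 1) → ∀ s, 0 < s →
    1 - (c / η ^ 2 + c) * s ≤ u y s
  differentiableAt : ∀ t, 0 < t → ∀ x, DifferentiableAt ℝ (fun y => u y t) x

theorem IsSolution.boundedFlow (h : IsSolution ε u₀ u) (h₀ : ∀ x, |u₀ x| ≤ 1)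
    (hcont : ContinuousOn (fun p : Space n × ℝ => u p.1 p.2) (univ ×ˢ Ioi 0)) :
    BoundedFlow (1 / ε ^ 2) u₀ u := by
  have hb : ∀ x s, 0 < s → |u x s| ≤ 1 := fun x s hs => abs_le.2 ⟨h.neg_one_le h₀ hcont hs x, by
    have := h.neg.neg_one_le (fun x => by rw [abs_neg]; exact h₀ x) hcont.neg hs x
    linarith⟩
  refine ⟨h.heatLimit h₀ hcont, hb, ⟨16 * (n + 1) + 4 * (1 / ε ^ 2), by positivity,
    fun y η hη hy s hs => ?_⟩, fun t ht x => h.differentiableAt h₀ hcont ht x⟩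
  have hk : ∀ᶠ k : ℕ in atTop, 1 / ((k : ℝ) + 1) < η / 2 :=
    tendsto_one_div_add_atTop_nhds_zero_nat.eventually (gt_mem_nhds (half_pos hη))
  -- With b = 8/η² the parabola 1 - b‖x - y‖² has dropped to -1 at distance η/2. Inside that
  -- distance a kernel of radius below η/2 sees only the datum 1.
  have h1 : 1 - 8 / η ^ 2 * (2 * (n + 1) * s) - 1 / ε ^ 2 * (2 * 1 * (1 ^ 2 + 1)) * s ≤
      u y s := by
    refine ge_of_tendsto (tendsto_mollify_mollifier hcont y hs) (hk.mono fun k hk => ?_)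
    refine h.le_mollify h₀ hcont (T := s + 1) (fun x r hr => hb x r hr.1) (fun r hr => ?_)
      (by positivity) (fun x => ?_) ⟨hs, lt_add_one s⟩
    · rcases hr.1.eq_or_lt with rfl | h1
      · filter_upwards [h.initial] with x hx
        rw [hx]
        exact h₀ x
      · exact Eventually.of_forall fun x => hb x r h1
    · by_cases hx : ‖x - y‖ < η / 2
      · have h2 : 1 ≤ mollify (fun y => u y 0) (mollifierKernel n k) x := by
          refine le_mollify_mollifierKernel (h.locallyIntegrable 0 le_rfl) ?_
          filter_upwards [h.initial] with z hz hd
          rw [hz, hy z]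
          rw [Metric.mem_ball]
          rw [← dist_eq_norm] at hx
          linarith [dist_triangle z x y]
        have h3 : 0 ≤ 8 / η ^ 2 * ‖x - y‖ ^ 2 := by positivity
        linarith
      · have h2 : -1 ≤ mollify (fun y => u y 0) (mollifierKernel n k) x := by
          refine le_mollify_mollifierKernel (h.locallyIntegrable 0 le_rfl) ?_
          filter_upwards [h.initial] with z hz _
          rw [hz]
          exact (abs_le.1 (h₀ z)).1
        have h3 : 2 ≤ 8 / η ^ 2 * ‖x - y‖ ^ 2 := by
          rw [div_mul_eq_mul_div, le_div_iff₀ (by positivity)]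
          nlinarith [not_lt.1 hx]
        linarith
  refine le_trans ?_ h1
  have h2 : 8 / η ^ 2 * (2 * (n + 1) * s) = 16 * (n + 1) / η ^ 2 * s := by ring
  have h3 : (16 * (n + 1) + 4 * (1 / ε ^ 2)) / η ^ 2 =
      16 * (n + 1) / η ^ 2 + 4 * (1 / ε ^ 2) / η ^ 2 := add_div _ _ _
  have h4 : 0 ≤ 4 * (1 / ε ^ 2) / η ^ 2 * s := by positivity
  have h5 : 0 ≤ 16 * ((n : ℝ) + 1) * s := by positivity
  rw [h2, h3]
  nlinarith

end Regularity

/-! ### Gaussian barriers -/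

section Barrier

variable {n : ℕ} {lam : ℝ} {u₀ : Space n → ℝ} {u : Space n → ℝ → ℝ}

/-- Comparison of a flow with a barrier on a ball on which the initial datum is `1`. -/
theorem BoundedFlow.barrier_le (h : BoundedFlow lam u₀ u) {y : Space n} {ρ ρ' T e κ : ℝ}
    {S σ : Space n → ℝ → ℝ} (hρ : ρ' < ρ) (hT : 0 < T) (hu₀ : ∀ x ∈ Metric.ball y ρ, u₀ x = 1)
    (hS : ClassicalHeat (Metric.closedBall y ρ' ×ˢ Ioc 0 T) S σ) (he : 0 < e)
    (hSe : ∀ x ∈ Metric.closedBall y ρ', ∀ s ∈ Ioc 0 T, S x s ≤ 1 - e)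
    (hlat : ∀ x, ‖x - y‖ = ρ' → ∀ s ∈ Ioc 0 T, S x s ≤ u x s)
    (hsrc : ∀ x ∈ Metric.ball y ρ', ∀ s ∈ Ioc 0 T, u x s < S x s →
      σ x s + lam * nonlinearity (u x s) ≤ κ * (S x s - u x s)) :
    ∀ x ∈ Metric.closedBall y ρ', S x T ≤ u x T := by
  obtain ⟨c, hc, hinit⟩ := h.initial
  set d := c / (ρ - ρ') ^ 2 + c with hd
  have hd0 : 0 < d := by positivity
  -- Comparison starts at a positive time, early enough that u ≥ 1 - d s₁ ≥ 1 - e on the smaller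
  -- ball; the gap ρ - ρ' makes d uniform there.
  set s₁ := min (T / 2) (e / d) with hs₁
  have hs₁0 : 0 < s₁ := by positivity
  have hs₁T : s₁ < T := (min_le_left _ _).trans_lt (half_lt_self hT)
  have hsub : Icc s₁ T ⊆ Ioc 0 T := fun r hr => ⟨hs₁0.trans_le hr.1, hr.2⟩
  have hsub' : Ioc s₁ T ⊆ Ioc 0 T := Ioc_subset_Icc_self.trans hsub
  have hheat := (hS.mono (D' := Metric.ball y ρ' ×ˢ Ioc s₁ T)
    (prod_mono Metric.ball_subset_closedBall hsub')).heatLimit.sub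
      (h.heatLimit.mono (prod_mono (subset_univ _) fun r hr => hs₁0.trans hr.1))
  intro x hx
  have := hheat.nonpos (isCompact_closedBall y ρ') Metric.isOpen_ball
    Metric.ball_subset_closedBall ?_ ?_ ?_ κ ?_ x hx T ⟨hs₁T.le, le_rfl⟩
  · linarith
  · exact (hS.continuousOn.mono (prod_mono le_rfl hsub)).sub (h.heatLimit.continuousOn.mono
      (prod_mono (subset_univ _) fun r hr => hs₁0.trans_le hr.1))
  · rintro x ⟨hx, hxU⟩ s hs
    rw [mem_closedBall_iff_norm] at hx
    rw [mem_ball_iff_norm, not_lt] at hxU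
    have := hlat x (le_antisymm hx hxU) s (hsub hs)
    linarith
  · intro x hx
    have h1 := hSe x hx s₁ ⟨hs₁0, hs₁T.le⟩
    have h2 := hinit x (ρ - ρ') (sub_pos.2 hρ) (fun z hz => hu₀ z (by
      rw [Metric.mem_ball] at hz ⊢
      rw [Metric.mem_closedBall] at hx
      linarith [dist_triangle z x y])) s₁ hs₁0
    have h3 : d * s₁ ≤ e := by
      have : s₁ ≤ e / d := min_le_right _ _
      rw [le_div_iff₀ hd0] at this
      linarith
    linarith
  · intro x hx s hs hpos
    have := hsrc x hx s (hsub' hs) (by linarith)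
    linarith

/-- The Gaussian barrier. -/
def gaussianBarrier (y : Space n) (A μ ρ T : ℝ) (x : Space n) (s : ℝ) : ℝ :=
  A * Real.exp (3 / (16 * T) / (1 - 3 * s / (4 * T)) * ‖x - y‖ ^ 2 +
    (3 * (n + 1) / (2 * T) + μ) * s - 3 / (16 * T) * ρ ^ 2)

theorem gaussianBarrier_denom_ge {s T : ℝ} (hT : 0 < T) (hs : s ≤ T) :
    1 / 4 ≤ 1 - 3 * s / (4 * T) := by
  have : 3 * s / (4 * T) ≤ 3 / 4 := by
    rw [div_le_div_iff₀ (by positivity) (by norm_num)]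
    linarith
  linarith

/-- The coefficient α(s) = 3/(16T) / (1 - 3s/(4T)) of ‖x - y‖² solves α' = 4α². This cancels the
quadratic term of the Laplacian and leaves only 2(n + 1)α, which stays bounded because α blows up at
4T/3 > T. -/
theorem classicalHeat_gaussianBarrier (y : Space n) (A μ ρ : ℝ) {T : ℝ} (hT : 0 < T)
    {D : Set (Space n × ℝ)} (hD : D ⊆ univ ×ˢ Ioc 0 T) :
    ClassicalHeat D (gaussianBarrier y A μ ρ T) (fun x s => gaussianBarrier y A μ ρ T x s *
      (3 * (n + 1) / (2 * T) + μ - 3 * (n + 1) / (8 * T) / (1 - 3 * s / (4 * T)))) := by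
  have hg : ∀ p ∈ D, 1 - 3 * p.2 / (4 * T) ≠ 0 := fun p hp => by
    have := gaussianBarrier_denom_ge hT (hD hp).2.2
    exact (lt_of_lt_of_le (by norm_num) this).ne'
  refine ⟨?_, fun p hp => ⟨_, HasLaplacianAt.radial y p.1
    (φ := fun q => A * Real.exp (3 / (16 * T) / (1 - 3 * p.2 / (4 * T)) * q +
      (3 * (n + 1) / (2 * T) + μ) * p.2 - 3 / (16 * T) * ρ ^ 2))
    (φ' := fun q => A * (Real.exp (3 / (16 * T) / (1 - 3 * p.2 / (4 * T)) * q +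
      (3 * (n + 1) / (2 * T) + μ) * p.2 - 3 / (16 * T) * ρ ^ 2) *
        (3 / (16 * T) / (1 - 3 * p.2 / (4 * T)))))
    (φ'' := A * ((Real.exp (3 / (16 * T) / (1 - 3 * p.2 / (4 * T)) * ‖p.1 - y‖ ^ 2 +
      (3 * (n + 1) / (2 * T) + μ) * p.2 - 3 / (16 * T) * ρ ^ 2) *
        (3 / (16 * T) / (1 - 3 * p.2 / (4 * T)))) * (3 / (16 * T) / (1 - 3 * p.2 / (4 * T)))))
    (Eventually.of_forall fun q => ?_) ?_, ?_⟩⟩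
  · unfold gaussianBarrier
    refine continuousOn_const.mul (Real.continuous_exp.comp_continuousOn ?_)
    refine ((ContinuousOn.mul ?_ (by fun_prop)).add (by fun_prop)).sub continuousOn_const
    exact continuousOn_const.div (by fun_prop) hg
  · exact (((((hasDerivAt_id q).const_mul _).add_const _).sub_const _).exp.const_mul
      A).congr_deriv (by simp)
  · exact ((((((hasDerivAt_id (‖p.1 - y‖ ^ 2)).const_mul _).add_const _).sub_const
      _).exp.mul_const _).const_mul A).congr_deriv (by simp)
  · have h1 : HasDerivAt (fun s : ℝ => 1 - 3 * s / (4 * T)) (-(3 / (4 * T))) p.2 :=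
      ((((hasDerivAt_id p.2).const_mul 3).div_const (4 * T)).const_sub 1).congr_deriv (by simp)
    have h2 := ((((((hasDerivAt_const p.2 (3 / (16 * T))).div h1 (hg p hp)).mul_const
      (‖p.1 - y‖ ^ 2)).add ((hasDerivAt_id p.2).const_mul
        (3 * ((n : ℝ) + 1) / (2 * T) + μ))).sub_const (3 / (16 * T) * ρ ^ 2)).exp).const_mul A
    refine h2.congr_deriv ?_
    have h3 := hg p hp
    simp only [gaussianBarrier, id, Pi.div_apply, Pi.add_apply]
    set g := 1 - 3 * p.2 / (4 * T) with hgdef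
    set E := Real.exp (3 / (16 * T) / g * ‖p.1 - y‖ ^ 2 +
      (3 * (n + 1) / (2 * T) + μ) * p.2 - 3 / (16 * T) * ρ ^ 2) with hE
    field_simp
    ring

theorem gaussianBarrier_ge (y : Space n) {A μ ρ T : ℝ} (hA : 0 ≤ A) (hμ : 0 ≤ μ) (hT : 0 < T)
    (x : Space n) {s : ℝ} (hs : s ∈ Ioc 0 T) :
    A * Real.exp (3 / (16 * T) * (‖x - y‖ ^ 2 - ρ ^ 2)) ≤ gaussianBarrier y A μ ρ T x s := by
  unfold gaussianBarrier
  have hs0 : 0 < s := hs.1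
  have h1 := gaussianBarrier_denom_ge hT hs.2
  have h2 : 1 - 3 * s / (4 * T) ≤ 1 := by
    have : 0 ≤ 3 * s / (4 * T) := by positivity
    linarith
  have h3 : 3 / (16 * T) ≤ 3 / (16 * T) / (1 - 3 * s / (4 * T)) := by
    rw [le_div_iff₀ (by linarith)]
    exact mul_le_of_le_one_right (by positivity) h2
  have h4 : 3 / (16 * T) * ‖x - y‖ ^ 2 ≤
      3 / (16 * T) / (1 - 3 * s / (4 * T)) * ‖x - y‖ ^ 2 := by gcongr
  have h5 : 0 ≤ (3 * (n + 1) / (2 * T) + μ) * s := by positivity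
  gcongr
  linarith

theorem gaussianBarrier_source_ge {μ s T : ℝ} (hT : 0 < T) (hs : s ≤ T) :
    μ ≤ 3 * ((n : ℝ) + 1) / (2 * T) + μ - 3 * (n + 1) / (8 * T) / (1 - 3 * s / (4 * T)) := by
  have h1 := gaussianBarrier_denom_ge hT hs
  have h2 : 3 * ((n : ℝ) + 1) / (8 * T) / (1 - 3 * s / (4 * T)) ≤ 3 * (n + 1) / (2 * T) := by
    rw [div_le_iff₀ (by linarith)]
    calc 3 * ((n : ℝ) + 1) / (8 * T) = 3 * (n + 1) / (2 * T) * (1 / 4) := by ring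
      _ ≤ _ := by gcongr
  linarith

/-- A is the allowed deficit 1 - u on the sphere and μ the linear growth rate of the deficit caused
by the reaction; the barrier carries both to the centre with a Gaussian factor. -/
theorem BoundedFlow.one_sub_gaussianBarrier_le (h : BoundedFlow lam u₀ u) {y : Space n}
    {ρ ρ' T A μ : ℝ} (hρ' : ρ' < ρ) (hT : 0 < T) (hu₀ : ∀ x ∈ Metric.ball y ρ, u₀ x = 1)
    (hA : 0 < A) (hμ : 0 ≤ μ) (hlat : ∀ x, ‖x - y‖ = ρ' → ∀ s ∈ Ioc 0 T, 1 - A ≤ u x s)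
    (hsrc : ∀ x ∈ Metric.ball y ρ', ∀ s ∈ Ioc 0 T,
      lam * nonlinearity (u x s) ≤ μ * (1 - u x s)) (hρ'0 : 0 ≤ ρ') :
    1 - A * Real.exp (3 * (n + 1) / 2 + μ * T - 3 / (16 * T) * ρ' ^ 2) ≤ u y T := by
  have hcl : ClassicalHeat (Metric.closedBall y ρ' ×ˢ Ioc 0 T)
      (fun x s => 1 - gaussianBarrier y A μ ρ' T x s)
      (fun x s => 0 - gaussianBarrier y A μ ρ' T x s *
      (3 * (n + 1) / (2 * T) + μ - 3 * (n + 1) / (8 * T) / (1 - 3 * s / (4 * T)))) := by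
    refine ClassicalHeat.sub ⟨continuousOn_const, fun p _ => ⟨0, HasLaplacianAt.const 1, ?_⟩⟩
      (classicalHeat_gaussianBarrier y A μ ρ' hT (prod_mono (subset_univ _) le_rfl))
    exact (hasDerivAt_const _ _).congr_deriv (by simp)
  have key := h.barrier_le (κ := μ) (e := A * Real.exp (3 / (16 * T) * (0 - ρ' ^ 2))) hρ' hT hu₀
    hcl (by positivity) ?_ ?_ ?_ y (Metric.mem_closedBall_self hρ'0)
  · refine le_trans (le_of_eq ?_) key
    simp only [gaussianBarrier, sub_self, norm_zero]
    congr 3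
    field_simp
    ring
  · intro x _ s hs
    have h1 := gaussianBarrier_ge y (ρ := ρ') hA.le hμ hT x hs
    have h2 : A * Real.exp (3 / (16 * T) * (0 - ρ' ^ 2)) ≤
        A * Real.exp (3 / (16 * T) * (‖x - y‖ ^ 2 - ρ' ^ 2)) := by
      gcongr
      positivity
    linarith
  · intro x hx s hs
    have h1 := gaussianBarrier_ge y (ρ := ρ') hA.le hμ hT x hs
    rw [hx, sub_self, mul_zero, Real.exp_zero, mul_one] at h1
    linarith [hlat x hx s hs]
  · intro x hx s hs _
    have h1 := hsrc x hx s hs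
    have h2 : 0 ≤ gaussianBarrier y A μ ρ' T x s :=
      le_trans (by positivity) (gaussianBarrier_ge y (ρ := ρ') hA.le hμ hT x hs)
    have h3 := mul_le_mul_of_nonneg_left (gaussianBarrier_source_ge (n := n) (μ := μ) hT hs.2) h2
    linarith

/-- Where the flow is non-negative it converges to `1` at a Gaussian rate. -/
theorem BoundedFlow.one_sub_exp_le (h : BoundedFlow lam u₀ u) (hlam : 0 ≤ lam) {y : Space n}
    {ρ ρ' T : ℝ} (hρ' : ρ' < ρ) (hρ'0 : 0 ≤ ρ') (hT : 0 < T)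
    (hu₀ : ∀ x ∈ Metric.ball y ρ, u₀ x = 1)
    (hpos : ∀ x ∈ Metric.closedBall y ρ', ∀ s ∈ Ioc 0 T, 0 ≤ u x s) :
    1 - Real.exp (3 * (n + 1) / 2 - 3 / (16 * T) * ρ' ^ 2) ≤ u y T := by
  have := h.one_sub_gaussianBarrier_le (A := 1) (μ := 0) hρ' hT hu₀ one_pos le_rfl
    (fun x hx s hs => ?_) (fun x hx s hs => ?_) hρ'0
  · simpa using this
  · rw [sub_self]
    exact hpos x (mem_closedBall_iff_norm.2 hx.le) s hs
  · have h1 := hpos x (Metric.ball_subset_closedBall hx) s hs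
    have h2 := (abs_le.1 (h.abs_le_one x s hs.1)).2
    rw [zero_mul]
    refine mul_nonpos_of_nonneg_of_nonpos hlam ?_
    unfold nonlinearity
    exact mul_nonpos_of_nonneg_of_nonpos (by linarith) (by nlinarith)

/-- From u ≥ -1 one may take A = 2. The identity (1 - u)/2 - f(u) = (1 - u)(2u + 1)²/2 gives μ =
lam/2, so for lam T ≤ 3 the reaction costs at most 3/2 in the exponent, and 2 exp(-27/16) ≤ 2/5. -/
theorem BoundedFlow.three_fifths_le_of_small (h : BoundedFlow lam u₀ u) (hlam : 0 ≤ lam)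
    {y : Space n} {ρ T : ℝ} (hT : 0 < T) (hlamT : lam * T ≤ 3)
    (hρ : 5 * √((n + 1) * T) < ρ) (hu₀ : ∀ x ∈ Metric.ball y ρ, u₀ x = 1) :
    3 / 5 ≤ u y T := by
  have hsq : (5 * √((n + 1) * T)) ^ 2 = 25 * ((n + 1) * T) := by
    rw [mul_pow, Real.sq_sqrt (by positivity)]
    norm_num
  have h1 := h.one_sub_gaussianBarrier_le (A := 2) (μ := lam / 2) hρ hT hu₀ two_pos
    (by positivity) (fun x hx s hs => ?_) (fun x hx s hs => ?_) (by positivity)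
  · rw [hsq] at h1
    have h2 : 3 * ((n : ℝ) + 1) / 2 + lam / 2 * T - 3 / (16 * T) * (25 * ((n + 1) * T)) ≤
        -(27 / 16) := by
      have h3 : 3 / (16 * T) * (25 * (((n : ℝ) + 1) * T)) = 75 / 16 * (n + 1) := by
        field_simp
        ring
      rw [h3]
      have : (0 : ℝ) ≤ n := Nat.cast_nonneg n
      linarith
    have h3 := Real.exp_le_exp.2 h2
    have h4 : (5 : ℝ) ≤ Real.exp (27 / 16) := by
      refine le_trans ?_ (Real.sum_le_exp_of_nonneg (by norm_num) 5)
      norm_num [Finset.sum_range_succ, Nat.factorial]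
    rw [Real.exp_neg] at h3
    have h5 : (Real.exp (27 / 16))⁻¹ ≤ 1 / 5 := by
      rw [inv_eq_one_div]
      exact one_div_le_one_div_of_le (by norm_num) h4
    linarith
  · have := (abs_le.1 (h.abs_le_one x s hs.1)).1
    linarith
  · have h2 := (abs_le.1 (h.abs_le_one x s hs.1)).2
    have h3 : nonlinearity (u x s) ≤ 1 / 2 * (1 - u x s) := by
      unfold nonlinearity
      nlinarith [mul_nonneg (sub_nonneg.2 h2) (sq_nonneg (2 * u x s + 1))]
    have h4 := mul_le_mul_of_nonneg_left h3 hlam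
    linarith

end Barrier

/-! ### Travelling fronts on shrinking spheres -/

section Front

theorem hasDerivAt_tanh (x : ℝ) : HasDerivAt Real.tanh (1 - Real.tanh x ^ 2) x := by
  have h := (Real.hasDerivAt_sinh x).div (Real.hasDerivAt_cosh x) (Real.cosh_pos x).ne'
  have h1 : Real.tanh = fun x => Real.sinh x / Real.cosh x :=
    funext Real.tanh_eq_sinh_div_cosh
  rw [h1]
  refine h.congr_deriv ?_
  have := (Real.cosh_pos x).ne'
  field_simp

theorem one_sub_exp_le_tanh (x : ℝ) : 1 - 2 * Real.exp (-2 * x) ≤ Real.tanh x := by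
  have h1 := Real.exp_pos x
  have h2 := Real.exp_pos (-x)
  have h3 : Real.exp (-2 * x) * Real.exp x = Real.exp (-x) := by
    rw [← Real.exp_add]
    ring_nf
  rw [Real.tanh_eq, le_div_iff₀ (by positivity)]
  nlinarith [Real.exp_pos (-2 * x), mul_pos (Real.exp_pos (-2 * x)) h2]

theorem tanh_le_exp_sub_one (x : ℝ) : Real.tanh x ≤ 2 * Real.exp (2 * x) - 1 := by
  have := one_sub_exp_le_tanh (-x)
  rw [Real.tanh_neg] at this
  have h : -2 * -x = 2 * x := by ring
  rw [h] at this
  linarith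

theorem tanh_nonneg {x : ℝ} (hx : 0 ≤ x) : 0 ≤ Real.tanh x := by
  rw [Real.tanh_eq_sinh_div_cosh]
  exact div_nonneg (Real.sinh_nonneg_iff.2 hx) (Real.cosh_pos x).le

theorem tanh_mul_nonneg (x : ℝ) : 0 ≤ Real.tanh x * x := by
  rcases le_total 0 x with hx | hx
  · exact mul_nonneg (tanh_nonneg hx) hx
  · have := mul_nonneg (tanh_nonneg (neg_nonneg.2 hx)) (neg_nonneg.2 hx)
    rwa [Real.tanh_neg, neg_mul_neg] at this

/-- The differential inequality for the shifted travelling front. -/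
theorem front_source_nonpos {m a r q δ τ : ℝ} (hm : 0 ≤ m) (ha : 0 < a) (hr : 0 < r) (hq : 0 ≤ q)
    (hδ : 0 ≤ δ) (hδ1 : δ ≤ 1) (hδr : 12 * a * δ * r ≤ 1) (hτ : τ ^ 2 ≤ 1)
    (hsign : τ * (q - r ^ 2) ≤ 0) :
    (1 - τ ^ 2) * (-(a * (4 * m + 1) * (r ^ 2 + q) / (4 * r * r ^ 2)) +
      2 * τ * a ^ 2 * q / r ^ 2 + m * a / r) + a ^ 2 * nonlinearity (τ - δ) ≤ 0 := by
  -- Shrinking at rate 4m + 1 in the squared radius beats the curvature term m a / r with a / (4r)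
  -- to spare; `h4` spends this on the shift δ.
  have h1 : -(a * (4 * m + 1) * (r ^ 2 + q) / (4 * r * r ^ 2)) + m * a / r ≤ -(a / (4 * r)) := by
    have h2 : -(a * (4 * m + 1) * (r ^ 2 + q) / (4 * r * r ^ 2)) + m * a / r + a / (4 * r) =
        -(a * (4 * m + 1) * q / (4 * r * r ^ 2)) := by
      field_simp
      ring
    have h3 : 0 ≤ a * (4 * m + 1) * q / (4 * r * r ^ 2) := by positivity
    linarith
  have h4 : 3 * a ^ 2 * δ ≤ a / (4 * r) := by
    rw [le_div_iff₀ (by positivity)]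
    nlinarith
  -- By `hsign`, replacing q by r² can only increase the term, for either sign of τ. The profile
  -- then satisfies the stationary equation, and only terms with a factor δ remain.
  have h5 : 2 * τ * a ^ 2 * q / r ^ 2 ≤ 2 * τ * a ^ 2 := by
    rw [div_le_iff₀ (by positivity)]
    nlinarith [mul_nonneg (sq_nonneg a) (neg_nonneg.2 hsign)]
  have h6 : (1 - τ ^ 2) * (-(a * (4 * m + 1) * (r ^ 2 + q) / (4 * r * r ^ 2)) +
      2 * τ * a ^ 2 * q / r ^ 2 + m * a / r) ≤ (1 - τ ^ 2) * (2 * τ * a ^ 2 - 3 * a ^ 2 * δ) :=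
    mul_le_mul_of_nonneg_left (by linarith) (by linarith)
  have h7 : (1 - τ ^ 2) * (2 * τ * a ^ 2 - 3 * a ^ 2 * δ) + a ^ 2 * nonlinearity (τ - δ) =
      a ^ 2 * δ * (-1 - 3 * τ ^ 2 + 6 * τ * δ - 2 * δ ^ 2) := by
    unfold nonlinearity
    ring
  have h8 : a ^ 2 * δ * (-1 - 3 * τ ^ 2 + 6 * τ * δ - 2 * δ ^ 2) ≤ 0 :=
    mul_nonpos_of_nonneg_of_nonpos (by positivity) (by nlinarith [sq_nonneg (τ - δ)])
  linarith

variable {n : ℕ} {lam : ℝ} {u₀ : Space n → ℝ} {u : Space n → ℝ → ℝ}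

/-- A travelling front along a family of shrinking spheres. -/
def frontBarrier (y : Space n) (a δ : ℝ) (P : ℝ → ℝ) (x : Space n) (s : ℝ) : ℝ :=
  Real.tanh (a * (P s - ‖x - y‖ ^ 2) / (2 * √(P s))) - δ

/-- With r = √P, the argument a(r² - ‖x - y‖²)/(2r) behaves like a(r - ‖x - y‖) near the sphere but
is smooth at the centre. -/
theorem classicalHeat_frontBarrier (y : Space n) (a δ K c : ℝ) {D : Set (Space n × ℝ)}
    (hD : ∀ p ∈ D, 0 < c - K * p.2) :
    ClassicalHeat D (frontBarrier y a δ fun s => c - K * s) (fun x s =>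
      (1 - Real.tanh (a * (c - K * s - ‖x - y‖ ^ 2) / (2 * √(c - K * s))) ^ 2) *
        (-(a * K * (√(c - K * s) ^ 2 + ‖x - y‖ ^ 2) / (4 * √(c - K * s) * √(c - K * s) ^ 2)) +
          2 * Real.tanh (a * (c - K * s - ‖x - y‖ ^ 2) / (2 * √(c - K * s))) * a ^ 2 *
            ‖x - y‖ ^ 2 / √(c - K * s) ^ 2 + (n + 1) * a / √(c - K * s))) := by
  have htc : Continuous Real.tanh := continuous_iff_continuousAt.2 fun x =>
    (hasDerivAt_tanh x).continuousAt
  refine ⟨?_, fun p hp => ?_⟩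
  · refine ContinuousOn.sub (htc.comp_continuousOn ?_) continuousOn_const
    refine ContinuousOn.div (Continuous.continuousOn (by fun_prop))
      (Continuous.continuousOn (by fun_prop)) fun p hp => ?_
    have := Real.sqrt_pos.2 (hD p hp)
    positivity
  · set r := √(c - K * p.2) with hr
    have hP := hD p hp
    have hr0 : 0 < r := Real.sqrt_pos.2 hP
    have hr2 : r ^ 2 = c - K * p.2 := Real.sq_sqrt hP.le
    have hin : ∀ q : ℝ, HasDerivAt (fun q => a * (c - K * p.2 - q) / (2 * r)) (-a / (2 * r)) q :=
      fun q => ((((hasDerivAt_id q).const_sub (c - K * p.2)).const_mul a).div_const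
        (2 * r)).congr_deriv (by ring)
    have hφ : ∀ q : ℝ, HasDerivAt (fun q => Real.tanh (a * (c - K * p.2 - q) / (2 * r)))
        ((1 - Real.tanh (a * (c - K * p.2 - q) / (2 * r)) ^ 2) * (-a / (2 * r))) q := fun q =>
      (hasDerivAt_tanh _).comp q (hin q)
    have hlap := HasLaplacianAt.radial y p.1
      (φ := fun q => Real.tanh (a * (c - K * p.2 - q) / (2 * r)) - δ)
      (Eventually.of_forall fun q => (hφ q).sub_const δ)
      ((((hφ (‖p.1 - y‖ ^ 2)).pow 2).const_sub 1).mul_const (-a / (2 * r)))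
    refine ⟨_, hlap, ?_⟩
    have hPd : HasDerivAt (fun s : ℝ => c - K * s) (-K) p.2 :=
      (((hasDerivAt_id p.2).const_mul K).const_sub c).congr_deriv (by simp)
    have hrd := hPd.sqrt hP.ne'
    have hwd := (((hPd.sub_const (‖p.1 - y‖ ^ 2)).const_mul a).div (hrd.const_mul 2)
      (by positivity : (2 * r) ≠ 0))
    have h1 := (((hasDerivAt_tanh _).comp p.2 hwd).sub_const δ)
    refine h1.congr_deriv ?_
    simp only [← hr, Pi.div_apply]
    set τ := Real.tanh (a * (c - K * p.2 - ‖p.1 - y‖ ^ 2) / (2 * r)) with hτ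
    rw [← hr2]
    field_simp
    ring

/-- The cubic part is increasing, so only -2s contributes. This one-sided bound supplies the
constant κ = 2 lam in the front comparison. -/
theorem nonlinearity_sub_le {p q : ℝ} (h : p ≤ q) :
    nonlinearity p - nonlinearity q ≤ 2 * (q - p) := by
  have h1 : p ^ 3 ≤ q ^ 3 := (Odd.strictMono_pow (by decide : Odd 3)).monotone h
  unfold nonlinearity
  nlinarith

/-- With k = √((n+1)T), the front radius shrinks from 3k but stays at least 2k up to time T, and at
distance 5k the barrier is below -1. All exponentials are controlled by z = √lam k ≥ 3/2, as z² ≥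
lam T ≥ 3. -/
theorem BoundedFlow.three_fifths_le_of_large (h : BoundedFlow lam u₀ u) (hlam : 0 ≤ lam)
    {y : Space n} {ρ T : ℝ} (hT : 0 < T) (hlamT : 3 ≤ lam * T)
    (hρ : 5 * √((n + 1) * T) < ρ) (hu₀ : ∀ x ∈ Metric.ball y ρ, u₀ x = 1) :
    3 / 5 ≤ u y T := by
  have hlam0 : 0 < lam := by
    by_contra hneg
    have : lam = 0 := le_antisymm (not_lt.1 hneg) hlam
    rw [this] at hlamT
    linarith
  set m : ℝ := n + 1 with hm
  have hm1 : 1 ≤ m := by simp [hm]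
  set k := √(m * T) with hk
  have hk2 : k ^ 2 = m * T := Real.sq_sqrt (by positivity)
  have hk0 : 0 < k := Real.sqrt_pos.2 (by positivity)
  set a := √lam with ha
  have ha0 : 0 < a := Real.sqrt_pos.2 hlam0
  have ha2 : a ^ 2 = lam := Real.sq_sqrt hlam
  set z := a * k with hz
  have hz0 : 0 < z := by positivity
  have hz2 : 3 ≤ z ^ 2 := by
    rw [hz, mul_pow, ha2, hk2]
    nlinarith
  have hz1 : 3 / 2 ≤ z := by nlinarith
  -- The largest shift allowed by 12 a δ r ≤ 1 for r up to 3k. It is still large enough to push the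
  -- outer tail of tanh below -1.
  set δ := 1 / (36 * z) with hδ
  have hδ0 : 0 < δ := by positivity
  have hδ1 : δ ≤ 1 / 36 := by
    rw [hδ]
    apply one_div_le_one_div_of_le <;> linarith
  set K := 4 * m + 1 with hK
  have hP : ∀ s ∈ Icc 0 T, 4 * (m * T) ≤ 9 * (m * T) - K * s := fun s hs => by
    have : K * s ≤ (5 * m) * T :=
      mul_le_mul (by linarith) hs.2 hs.1 (by positivity)
    linarith
  have hP9 : ∀ s ∈ Icc 0 T, 9 * (m * T) - K * s ≤ 9 * (m * T) := fun s hs => by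
    have : 0 ≤ K * s := mul_nonneg (by positivity) hs.1
    linarith
  have hmT : 0 < m * T := by positivity
  have hr : ∀ s ∈ Icc 0 T, 0 < √(9 * (m * T) - K * s) ∧ 2 * k ≤ √(9 * (m * T) - K * s) ∧
      √(9 * (m * T) - K * s) ≤ 3 * k ∧
      √(9 * (m * T) - K * s) ^ 2 = 9 * (m * T) - K * s := fun s hs => by
    have h1 := hP s hs
    have h2 := hP9 s hs
    refine ⟨Real.sqrt_pos.2 (by linarith), Real.le_sqrt_of_sq_le ?_,
      Real.sqrt_le_iff.2 ⟨by positivity, ?_⟩, Real.sq_sqrt (by linarith)⟩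
    · rw [mul_pow, hk2]; linarith
    · rw [mul_pow, hk2]; linarith
  have key := h.barrier_le (κ := 2 * lam) (e := δ) hρ hT hu₀
    (classicalHeat_frontBarrier y a δ K (9 * (m * T)) (fun p hp => by
      have := hP p.2 (Ioc_subset_Icc_self hp.2)
      linarith)) hδ0 ?_ ?_ ?_ y (Metric.mem_closedBall_self (by positivity))
  · refine le_trans ?_ key
    obtain ⟨h1, h2, h3, h4⟩ := hr T ⟨hT.le, le_rfl⟩
    simp only [frontBarrier, sub_self, norm_zero]
    set r := √(9 * (m * T) - K * T) with hrdef
    rw [← h4]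
    have h5 : a * (r ^ 2 - 0 ^ 2) / (2 * r) = a * r / 2 := by
      field_simp
      ring
    rw [h5]
    have h6 : 3 / 2 ≤ a * r / 2 := by
      have : a * (2 * k) ≤ a * r := mul_le_mul_of_nonneg_left h2 ha0.le
      linarith
    have h7 := one_sub_exp_le_tanh (a * r / 2)
    have h8 : Real.exp (-2 * (a * r / 2)) ≤ Real.exp (-3) := Real.exp_le_exp.2 (by linarith)
    have h9 : (10 : ℝ) ≤ Real.exp 3 := by
      refine le_trans ?_ (Real.sum_le_exp_of_nonneg (by norm_num) 5)
      norm_num [Finset.sum_range_succ, Nat.factorial]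
    have h10 : Real.exp (-3) ≤ 1 / 10 := by
      rw [Real.exp_neg, inv_eq_one_div]
      exact one_div_le_one_div_of_le (by norm_num) h9
    linarith
  · intro x _ s _
    have := (Real.tanh_lt_one (a * (9 * (m * T) - K * s - ‖x - y‖ ^ 2) /
      (2 * √(9 * (m * T) - K * s)))).le
    simp only [frontBarrier]
    linarith
  · intro x hx s hs
    refine le_trans ?_ (abs_le.1 (h.abs_le_one x s hs.1)).1
    obtain ⟨h1, h2, h3, h4⟩ := hr s (Ioc_subset_Icc_self hs)
    have h5 := hP9 s (Ioc_subset_Icc_self hs)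
    have hx2 : ‖x - y‖ ^ 2 = 25 * (m * T) := by
      rw [hx, mul_pow, hk2]
      norm_num
    simp only [frontBarrier, hx2]
    set r := √(9 * (m * T) - K * s) with hrdef
    have h6 : a * (9 * (m * T) - K * s - 25 * (m * T)) / (2 * r) ≤ -(8 / 3) * z := by
      rw [div_le_iff₀ (by positivity), hz]
      have h7 : a * (9 * (m * T) - K * s - 25 * (m * T)) ≤ a * (-16 * k ^ 2) :=
        mul_le_mul_of_nonneg_left (by rw [hk2]; linarith) ha0.le
      have h8 : a * k * r ≤ a * k * (3 * k) := mul_le_mul_of_nonneg_left h3 (by positivity)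
      linarith
    have h7 := tanh_le_exp_sub_one (a * (9 * (m * T) - K * s - 25 * (m * T)) / (2 * r))
    have h8 : Real.exp (2 * (a * (9 * (m * T) - K * s - 25 * (m * T)) / (2 * r))) ≤
        Real.exp (-(16 / 3 * z)) := Real.exp_le_exp.2 (by linarith)
    have h9 : 72 * z ≤ Real.exp (16 / 3 * z) := by
      refine le_trans ?_ (Real.sum_le_exp_of_nonneg (by positivity) 5)
      simp only [Finset.sum_range_succ, Finset.sum_range_zero, Nat.factorial]
      norm_num
      have h10 : z ^ 2 * 3 ≤ z ^ 2 * z ^ 2 := mul_le_mul_of_nonneg_left hz2 (sq_nonneg z)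
      have h11 : z * 3 ≤ z * z ^ 2 := mul_le_mul_of_nonneg_left hz2 hz0.le
      nlinarith
    have h10 : 2 * Real.exp (-(16 / 3 * z)) ≤ δ := by
      rw [Real.exp_neg, hδ, ← div_eq_mul_inv, div_le_div_iff₀ (Real.exp_pos _) (by positivity)]
      linarith
    linarith
  · intro x _ s hs hlt
    obtain ⟨h1, h2, h3, h4⟩ := hr s (Ioc_subset_Icc_self hs)
    set r := √(9 * (m * T) - K * s) with hrdef
    set τ := Real.tanh (a * (9 * (m * T) - K * s - ‖x - y‖ ^ 2) / (2 * r)) with hτ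
    have hS : frontBarrier y a δ (fun s => 9 * (m * T) - K * s) x s = τ - δ := rfl
    rw [hS] at hlt ⊢
    have h5 : 12 * a * δ * r ≤ 1 := by
      have h6 : 12 * a * δ * r ≤ 12 * a * δ * (3 * k) := by gcongr
      have h7 : 12 * a * δ * (3 * k) = 1 := by
        rw [hδ, hz]
        field_simp
        norm_num
      linarith
    have h6 : τ * (‖x - y‖ ^ 2 - r ^ 2) ≤ 0 := by
      have h7 := tanh_mul_nonneg (a * (9 * (m * T) - K * s - ‖x - y‖ ^ 2) / (2 * r))
      rw [← hτ, ← h4] at h7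
      have h8 : τ * (a * (r ^ 2 - ‖x - y‖ ^ 2) / (2 * r)) =
          a / (2 * r) * -(τ * (‖x - y‖ ^ 2 - r ^ 2)) := by ring
      rw [h8] at h7
      have h9 := nonneg_of_mul_nonneg_right h7 (by positivity)
      linarith
    have h7 := front_source_nonpos (m := m) (by linarith) ha0 h1 (sq_nonneg ‖x - y‖) hδ0.le
      (by linarith) h5 (Real.tanh_sq_lt_one _).le h6
    -- `h7` controls the reaction at the barrier value; this bounds the change on passing to the
    -- smaller value u.
    have h8 := mul_le_mul_of_nonneg_left (nonlinearity_sub_le hlt.le) hlam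
    rw [ha2] at h7
    rw [ha2]
    linarith

theorem BoundedFlow.three_fifths_le (h : BoundedFlow lam u₀ u) (hlam : 0 ≤ lam)
    {y : Space n} {ρ T : ℝ} (hT : 0 < T) (hρ : 5 * √((n + 1) * T) < ρ)
    (hu₀ : ∀ x ∈ Metric.ball y ρ, u₀ x = 1) : 3 / 5 ≤ u y T := by
  rcases le_total (lam * T) 3 with h1 | h1
  · exact h.three_fifths_le_of_small hlam hT h1 hρ hu₀
  · exact h.three_fifths_le_of_large hlam hT h1 hρ hu₀

end Front

/-! ### The Gaussian gradient bound -/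

section GradientBound

variable {n : ℕ} {lam : ℝ} {u₀ : Space n → ℝ} {u : Space n → ℝ → ℝ}

/-- The derivative of f is positive beyond 1/√3 < 3/5, which is why 3/5 is the threshold in the
positivity estimate. -/
theorem nonlinearity_le_of_le {p q : ℝ} (hp : 3 / 5 ≤ p) (h : p ≤ q) :
    nonlinearity p ≤ nonlinearity q := by
  unfold nonlinearity
  nlinarith [mul_nonneg (sub_nonneg.2 h) (by nlinarith : 0 ≤ q ^ 2 + p * q + p ^ 2 - 1)]

/-- The gradient bound at a point whose distance to the set where the datum is not `1` is large
on the parabolic scale. -/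
theorem BoundedFlow.norm_fderiv_sq_le (h : BoundedFlow lam u₀ u) (hlam : 0 ≤ lam) {x : Space n}
    {d t : ℝ} (ht : 0 < t) (hd : 6 * √((n : ℝ) + 1) * √t ≤ d)
    (hu₀ : ∀ z ∈ Metric.ball x d, u₀ z = 1) :
    ‖fderiv ℝ (fun y => u y t) x‖ ^ 2 ≤
      9 * (n + 1) ^ 2 * (n + 2) ^ 2 * Real.exp (94 * (n + 1)) / t *
        Real.exp (-d ^ 2 / (3 * t)) := by
  set m : ℝ := n + 1 with hm
  have hm1 : 1 ≤ m := by simp [hm]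
  set k := √(m * t) with hk
  have hk2 : k ^ 2 = m * t := Real.sq_sqrt (by positivity)
  have hk0 : 0 < k := Real.sqrt_pos.2 (by positivity)
  have hkd : 6 * k ≤ d := by
    rw [hk, Real.sqrt_mul (by positivity)]
    linarith
  have hst : √t ≤ k := Real.sqrt_le_sqrt (by nlinarith)
  have hst0 : 0 < √t := Real.sqrt_pos.2 ht
  have hst2 : √t ^ 2 = t := Real.sq_sqrt ht.le
  set r := √t / 4 with hr
  have hr0 : 0 < r := by positivity
  -- Decay is run on balls of radius ρ' about points of B(x, r). Their points still have a ball of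
  -- radius 11k/2 - r > 5k with datum 1, as positivity requires; d ≥ 6k keeps ρ' positive.
  set ρ' := d - 11 / 2 * k with hρ'
  have hmono : ∀ s ∈ Ioc 0 t, √((n + 1) * s) ≤ k := fun s hs =>
    Real.sqrt_le_sqrt (mul_le_mul_of_nonneg_left hs.2 (by positivity))
  have hball : ∀ {z : Space n} {e e' : ℝ}, z ∈ Metric.closedBall x e → e + e' ≤ d →
      ∀ z' ∈ Metric.ball z e', u₀ z' = 1 := fun {z e e'} hz he z' hz' => hu₀ z' (by
    rw [Metric.mem_ball] at hz' ⊢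
    rw [Metric.mem_closedBall] at hz
    linarith [dist_triangle z' z x])
  set N := Real.exp (3 * (n + 1) / 2 - 3 / (16 * t) * ρ' ^ 2) with hN
  have hsub : Icc (t / 2) t ⊆ Ioc 0 t := fun s hs => ⟨by linarith [hs.1], hs.2⟩
  have hone : ∀ z s, 0 < s → u z s ≤ 1 := fun z s hs => (abs_le.1 (h.abs_le_one z s hs)).2
  have hlow : ∀ z ∈ Metric.closedBall x r, ∀ s ∈ Ioc 0 t, 3 / 5 ≤ u z s := fun z hz s hs => by
    refine h.three_fifths_le hlam hs.1 (ρ := d - r) ?_ (hball hz (by linarith))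
    have := hmono s hs
    linarith
  have hdecay : ∀ z ∈ Metric.closedBall x r, ∀ s ∈ Ioc 0 t, 1 - N ≤ u z s := fun z hz s hs => by
    have hs0 : 0 < s := hs.1
    have h1 := h.one_sub_exp_le hlam (y := z) (ρ := d - r) (ρ' := ρ') (by linarith)
      (by linarith) hs0 (hball hz (by linarith)) (fun z' hz' s' hs' => by
        have h2 : z' ∈ Metric.closedBall x (ρ' + r) := by
          rw [Metric.mem_closedBall] at hz hz' ⊢
          linarith [dist_triangle z' z x]
        have h3 := h.three_fifths_le hlam hs'.1 (ρ := 11 / 2 * k - r)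
          (by have := hmono s' ⟨hs'.1, hs'.2.trans hs.2⟩; linarith) (hball h2 (by linarith))
        linarith)
    refine le_trans ?_ h1
    have h2 : 3 / (16 * t) ≤ 3 / (16 * s) := by
      have := hs.2
      gcongr
    have h3 : 3 / (16 * t) * ρ' ^ 2 ≤ 3 / (16 * s) * ρ' ^ 2 := by gcongr
    have h4 : Real.exp (3 * (n + 1) / 2 - 3 / (16 * s) * ρ' ^ 2) ≤ N :=
      Real.exp_le_exp.2 (by linarith)
    linarith
  have hN0 : 0 < N := Real.exp_pos _
  have hrefl : ∀ i, ∀ z ∈ Metric.closedBall x r, reflect x i z ∈ Metric.closedBall x r := by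
    intro i z hz
    rw [mem_closedBall_iff_norm] at hz ⊢
    rwa [norm_reflect_sub]
  have hheat := h.heatLimit.mono (D' := Metric.closedBall x r ×ˢ Icc (t / 2) t)
    (prod_mono (subset_univ _) fun s hs => (hsub hs).1)
  have hzero : ClassicalHeat (Metric.closedBall x r ×ˢ Icc (t / 2) t) (fun _ _ => 0)
      (fun _ _ => 0) := ⟨continuousOn_const, fun p _ => ⟨0, HasLaplacianAt.const 0,
        (hasDerivAt_const _ _).congr_deriv (by simp)⟩⟩
  -- The reflection estimate is one-sided; applied to -u it gives the opposite bound on each partial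
  -- derivative.
  have hheat' := hzero.heatLimit.sub hheat
  have hder := (h.differentiableAt t ht x).hasFDerivAt
  have hder' : HasFDerivAt (fun y => 0 - u y t) (-fderiv ℝ (fun y => u y t) x) x :=
    ((hasFDerivAt_const (0 : ℝ) x).sub hder).congr_fderiv (zero_sub _)
  have hcalc : ∀ {l : ℝ}, 2 * (t - t / 2) * l ≤
      ((t - t / 2) * N + r ^ 2 * ((t - t / 2) * 0 + N) / 2) * (n + 2) / r →
      l ≤ 3 * (n + 2) * N / √t := fun {l} hl => by
    rw [le_div_iff₀ hst0]
    have h1 : ((t - t / 2) * N + r ^ 2 * ((t - t / 2) * 0 + N) / 2) * (n + 2) / r =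
        17 / 8 * √t * ((n + 2) * N) := by
      rw [hr]
      field_simp
      rw [hst2]
      ring
    have h2 : 2 * (t - t / 2) * l = √t * (l * √t) := by
      calc 2 * (t - t / 2) * l = t * l := by ring
        _ = √t ^ 2 * l := by rw [hst2]
        _ = _ := by ring
    rw [h1, h2, mul_comm (17 / 8) (√t), mul_assoc] at hl
    have h3 := le_of_mul_le_mul_left hl hst0
    have h4 : 0 ≤ ((n : ℝ) + 2) * N := by positivity
    linarith
  have hpartial : ∀ i, |fderiv ℝ (fun y => u y t) x (coordVec i)| ≤ 3 * (n + 2) * N / √t := by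
    intro i
    refine abs_le.2 ⟨?_, hcalc (hheat.lineDeriv_le i hr0 (half_lt_self ht) le_rfl
      (fun z hz s hs => ?_) (fun z hz s hs hp => ?_) hder)⟩
    · have := hcalc (hheat'.lineDeriv_le i hr0 (half_lt_self ht) le_rfl
        (fun z hz s hs => ?_) (fun z hz s hs hp => ?_) hder')
      · rw [neg_apply] at this
        linarith
      · have h1 := hdecay z hz s (hsub hs)
        have h2 := hone (reflect x i z) s (hsub hs).1
        linarith
      -- Both values are at least 3/5, so monotonicity gives the reaction difference the favourable
      -- sign: M = 0, without any dependence on lam.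
      · have h1 := nonlinearity_le_of_le (hlow z hz s (hsub hs))
          (show u z s ≤ u (reflect x i z) s by linarith)
        have h2 := mul_le_mul_of_nonneg_left h1 hlam
        linarith
    · have h1 := hdecay _ (hrefl i z hz) s (hsub hs)
      have h2 := hone z s (hsub hs).1
      linarith
    · have h1 := nonlinearity_le_of_le (hlow _ (hrefl i z hz) s (hsub hs))
        (show u (reflect x i z) s ≤ u z s by linarith)
      have h2 := mul_le_mul_of_nonneg_left h1 hlam
      linarith
  have hnorm := norm_le_of_forall_coordVec _ hpartial
  have hN2 : N ^ 2 ≤ Real.exp (94 * m) * Real.exp (-d ^ 2 / (3 * t)) := by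
    rw [hN, ← Real.exp_nat_mul, ← Real.exp_add]
    refine Real.exp_le_exp.2 ?_
    -- Completing the square: the d² coefficient is 3/8 - 1/3 = 1/24, and 94 leaves the positive
    -- remainder m/4.
    have h1 : 94 * m + -d ^ 2 / (3 * t) - ((2 : ℕ) : ℝ) * (3 * (n + 1) / 2 -
        3 / (16 * t) * ρ' ^ 2) = (d - 99 / 2 * k) ^ 2 / (24 * t) + m / 4 := by
      rw [hρ', ← hm]
      field_simp
      push_cast
      linear_combination (-1672704 : ℝ) * hk2
    have h2 : 0 ≤ (d - 99 / 2 * k) ^ 2 / (24 * t) + m / 4 := by positivity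
    linarith
  calc ‖fderiv ℝ (fun y => u y t) x‖ ^ 2 ≤ (m * (3 * (n + 2) * N / √t)) ^ 2 :=
        pow_le_pow_left₀ (norm_nonneg _) hnorm 2
    _ = 9 * m ^ 2 * (n + 2) ^ 2 / t * N ^ 2 := by
        rw [mul_pow, div_pow, hst2]
        ring
    _ ≤ 9 * m ^ 2 * (n + 2) ^ 2 / t * (Real.exp (94 * m) * Real.exp (-d ^ 2 / (3 * t))) := by
        gcongr
    _ = _ := by ring

/-- The ball is connected and misses the frontier, so it cannot meet both the interior and the
exterior of A. -/
theorem ball_infDist_frontier_subset {A : Set (Space n)} {x : Space n} (hx : x ∈ A) :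
    Metric.ball x (Metric.infDist x (frontier A)) ⊆ A := by
  intro z hz
  by_contra hzA
  have hpos : 0 < Metric.infDist x (frontier A) := dist_nonneg.trans_lt (Metric.mem_ball.1 hz)
  have hcov : ∀ p ∈ Metric.ball x (Metric.infDist x (frontier A)),
      p ∈ interior A ∨ p ∈ (closure A)ᶜ := fun p hp => by
    have h := disjoint_left.1 Metric.disjoint_ball_infDist hp
    by_contra! hcon
    exact h ⟨not_not.1 hcon.2, hcon.1⟩
  have hx' := Metric.mem_ball_self hpos (x := x)
  obtain ⟨p, -, hp, hp'⟩ := (convex_ball x (Metric.infDist x (frontier A))).isPreconnected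
    (interior A) (closure A)ᶜ isOpen_interior isClosed_closure.isOpen_compl hcov
    ⟨x, hx', (hcov x hx').resolve_right fun h => h (subset_closure hx)⟩
    ⟨z, hz, (hcov z hz).resolve_left fun h => hzA (interior_subset h)⟩
  exact hp' (interior_subset_closure hp)

theorem abs_initialDatum_le (Ω : Set (Space n)) (x : Space n) : |initialDatum Ω x| ≤ 1 := by
  unfold initialDatum
  by_cases hx : x ∈ Ω
  · simp [hx]; norm_num
  · simp [hx]

theorem norm_gradient (f : Space n → ℝ) (x : Space n) : ‖gradient f x‖ = ‖fderiv ℝ f x‖ := by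
  simp [gradient]

end GradientBound

end AllenCahn

end

/-! ### The theorem: points inside and outside Ω -/

theorem mainTheorem9 (n : ℕ) :
    ∃ C : ℝ, 0 < C ∧
      ∀ (ε : ℝ) (_ : 0 < ε)
        (Ω M : Set (AllenCahn.Space n)) (_ : AllenCahn.IsGeneralisedHypersurface Ω M)
        (u : AllenCahn.Space n → ℝ → ℝ)
        (_ : AllenCahn.IsSolution ε (AllenCahn.initialDatum Ω) u)
        (_hcont : ContinuousOn (fun p : AllenCahn.Space n × ℝ => u p.1 p.2) (univ ×ˢ Ioi 0))
        (x : AllenCahn.Space n) (t : ℝ) (_ : 0 < t)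
        (_ : 6 * √((n : ℝ) + 1) * √t ≤ |AllenCahn.signedDist Ω M x|),
        DifferentiableAt ℝ (fun y => u y t) x ∧
          ‖gradient (fun y => u y t) x‖ ^ 2 ≤
            C / t * Real.exp (-(AllenCahn.signedDist Ω M x) ^ 2 / (3 * t)) := by
  refine ⟨9 * (n + 1) ^ 2 * (n + 2) ^ 2 * Real.exp (94 * (n + 1)), by positivity, ?_⟩
  intro ε _ Ω M hM u hu hcont x t ht hd
  have h₀ := AllenCahn.abs_initialDatum_le Ω
  have hflow := hu.boundedFlow h₀ hcont
  have hlam : 0 ≤ 1 / ε ^ 2 := by positivity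
  refine ⟨hflow.differentiableAt t ht x, ?_⟩
  rw [AllenCahn.norm_gradient]
  have hfr := hM.eq_frontier
  by_cases hx : x ∈ Ω
  · have hs : AllenCahn.signedDist Ω M x = Metric.infDist x M := by
      simp [AllenCahn.signedDist, hx]
    rw [hs] at hd ⊢
    rw [abs_of_nonneg Metric.infDist_nonneg] at hd
    refine hflow.norm_fderiv_sq_le hlam ht hd fun z hz => ?_
    rw [hfr] at hz
    have hz' := AllenCahn.ball_infDist_frontier_subset hx hz
    simp only [AllenCahn.initialDatum, indicator_of_mem hz']
    norm_num
  · have hs : AllenCahn.signedDist Ω M x = -Metric.infDist x M := by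
      simp [AllenCahn.signedDist, hx]
    rw [hs] at hd ⊢
    rw [abs_neg, abs_of_nonneg Metric.infDist_nonneg] at hd
    -- Outside Ω the datum of -u is 1, and Ω and its complement share the same frontier, so the
    -- interior case applies to -u.
    have hflow' := hu.neg.boundedFlow (fun x => by rw [abs_neg]; exact h₀ x) hcont.neg
    have hb := hflow'.norm_fderiv_sq_le hlam ht hd fun z hz => by
      rw [hfr, ← frontier_compl] at hz
      have hz' : z ∉ Ω :=
        AllenCahn.ball_infDist_frontier_subset (show x ∈ Ωᶜ from hx) hz
      simp only [AllenCahn.initialDatum, indicator_of_notMem hz']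
      norm_num
    rw [neg_sq]
    have hneg : fderiv ℝ (fun y => -u y t) x = -fderiv ℝ (fun y => u y t) x := fderiv_neg
    rwa [hneg, norm_neg] at hb
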